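/- **Definitions.** *Cauchy motion* is a process $(\mathcal L(u))_{u\in\mathbb R}$ with $\mathcal L(0)=0$ and independent increments such that $\mathcal L(v)-\mathcal L(u)$ has the Cauchy distribution $C(0,|v-u|)$ with location $0$ and scale $|v-u|$. For an integer $d\ge 0$, $\mathrm{CI}_d(0,1)$ is the law of the random vector $\int_0^1(1,x,\dots,x^d)\,\mathrm d\mathcal L(x)$, where the stochastic integral is the limit in probability of Riemann sums $\sum_i f(\xi_i)\,(\mathcal L(x_{i+1})-\mathcal L(x_i))$ as the mesh of the partition tends to $0$. A family of $m$ *piecewise degree-$d$-polynomial densities with $n$ pieces* is given by the sorted list $a_1\le\dots\le a_s$ of the endpoints occurring in the family, indices $b_{j1}<c_{j1}\le b_{j2}<c_{j2}\le\dots\le b_{jn}<c_{jn}$ in $\{1,\dots,s\}$ and coefficient vectors $\alpha_{j\ell}\in\mathbb R^{d+1}$, for $1\le j\le m$ and $1\le\ell\le n$. The $j$-th function is $f_j(x)=(1,x,\dots,x^d)\cdot\alpha_{j\ell}$ on $[a_{b_{j\ell}},a_{c_{j\ell}})$ for $\ell=1,\dots,n$, and $0$ elsewhere, and each $f_j$ is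 a probability density on $\mathbb R$. *Operations* are counted on a real RAM: arithmetic $+,-,\times$ on natural-number registers, loading and storing of array cells addressed through registers, conversion of a natural number to a real number, $+,-,\times,\div$ on real numbers, the root $(x,k)\mapsto|x|^{1/k}$, and comparisons cost one operation each. Drawing a fresh independent sample from $\mathrm{CI}_d(0,1)$ costs $T_d\ge 1$ operations. **Lemma.** There are one program for this machine and one absolute constant $K$ such that the following holds for all integers $d\ge0$, $m\ge1$, $n\ge 1$, $T_d\ge1$, all $\varepsilon>0$, all $\delta\in(0,1)$, every family $f_1,\dots,f_m$ of piecewise degree-$d$-polynomial densities with $n$ pieces, and every integer $t\ge(8/\varepsilon)^2\ln(m^2/\delta)$. On input $(d,m,n,s,t,\varepsilon,\delta,a,b,c,\alpha)$ the program always halts after at most $$K\,\bigl((d^2+T_d)\,mnt+m^2t\bigr)$$ operations, and it outputs numbers $D_{jk}$, $1\le j,k\le m$, such that with probability at least $1-\delta$, for all $j,k\in\{1,\dots,m\}$ simultaneously, $$(1-\varepsilon)D_{jk}\le\|f_j-f_k\|_1\le(1+\varepsilon)D_{jk}.$$ -/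

import Mathlib

open MeasureTheory ProbabilityTheory Filter Set

noncomputable section

namespace CauchyL1

/-! ### Cauchy motion, stochastic integrals, and the distribution `CI_d(a,b)` -/

/-- Cauchy motion `(L u)`, `u` real: it starts at `0`, has independent increments, and `L v - L u`
has the Cauchy distribution `C(0, |v - u|)`. -/
structure IsCauchyMotion {Ω : Type*} [MeasurableSpace Ω] (P : Measure Ω) (L : ℝ → Ω → ℝ) :
    Prop where
  measurable : ∀ u, Measurable (L u)
  zero : ∀ᵐ ω ∂P, L 0 ω = 0
  indep : HasIndepIncrements L P
  law : ∀ u v, HasLaw (fun ω => L v ω - L u ω) (cauchyMeasure 0 (Real.nnabs (v - u))) P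

/-- `Z = ∫_a^b f dL` for a (Riemann integrable) deterministic integrand `f`: the Riemann sums
`∑ f(ξ_i) (L(x_{i+1}) - L(x_i))` over tagged partitions `a = x_0 ≤ ξ_0 ≤ x_1 ≤ … ≤ x_N = b`
converge to `Z` in probability as the mesh tends to `0`. -/
def IsStochIntegral {Ω : Type*} [MeasurableSpace Ω] (P : Measure Ω) (L : ℝ → Ω → ℝ)
    (f : ℝ → ℝ) (a b : ℝ) (Z : Ω → ℝ) : Prop :=
  ∀ η : ℝ, 0 < η → ∃ ρ : ℝ, 0 < ρ ∧
    ∀ (N : ℕ) (x ξ : ℕ → ℝ), x 0 = a → x N = b →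
      (∀ i < N, x i ≤ ξ i ∧ ξ i ≤ x (i + 1) ∧ x (i + 1) - x i ≤ ρ) →
      P {ω | η ≤ |∑ i ∈ Finset.range N, f (ξ i) * (L (x (i + 1)) ω - L (x i) ω) - Z ω|}
        ≤ ENNReal.ofReal η

/-- `μ` is the distribution `CI_d(a,b)`, that is, the law of the random vector
`(Z_0, …, Z_d) = ∫_a^b (1, x, …, x^d) dL(x)`, where `L` is a Cauchy motion. -/
def IsCI (d : ℕ) (a b : ℝ) (μ : Measure (Fin (d + 1) → ℝ)) : Prop :=
  ∃ (Ω : Type) (_ : MeasurableSpace Ω) (P : Measure Ω) (L : ℝ → Ω → ℝ)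
    (Z : Ω → Fin (d + 1) → ℝ),
    IsProbabilityMeasure P ∧ IsCauchyMotion P L ∧
    (∀ k : Fin (d + 1), IsStochIntegral P L (fun x => x ^ (k : ℕ)) a b (fun ω => Z ω k)) ∧
    HasLaw Z μ P

/-! ### Families of piecewise polynomial functions -/

/-- A family of `m` piecewise degree-`d` polynomial functions, each with `n` pieces.
`a` is the sorted list of the endpoints that occur in the family, the `ℓ`-th piece of the `j`-th
function is the interval `[a (b j ℓ), a (c j ℓ))`, and `α j ℓ` is the vector of coefficients of
the polynomial on it. -/
structure PiecewiseFamily (d m n s : ℕ) where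
  a : Fin s → ℝ
  b : Fin m → Fin n → Fin s
  c : Fin m → Fin n → Fin s
  α : Fin m → Fin n → Fin (d + 1) → ℝ
  sorted : Monotone a
  b_lt_c : ∀ j ℓ, b j ℓ < c j ℓ
  c_le_b : ∀ j ℓ ℓ', ℓ < ℓ' → c j ℓ ≤ b j ℓ'
  endpoint : ∀ i, ∃ j ℓ, b j ℓ = i ∨ c j ℓ = i

namespace PiecewiseFamily

variable {d m n s : ℕ} (F : PiecewiseFamily d m n s)

/-- The `j`-th function of the family. -/
def fn (j : Fin m) (x : ℝ) : ℝ :=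
  ∑ ℓ, (Ico (F.a (F.b j ℓ)) (F.a (F.c j ℓ))).indicator
    (fun y => ∑ k : Fin (d + 1), F.α j ℓ k * y ^ (k : ℕ)) x

/-- All members of the family are probability densities. -/
def IsDensityFamily : Prop :=
  ∀ j, (∀ x, 0 ≤ F.fn j x) ∧ Integrable (F.fn j) ∧ ∫ x, F.fn j x = 1

/-- The distance `‖f_j - f_k‖_1`. -/
def dist (j k : Fin m) : ℝ := ∫ x, |F.fn j x - F.fn k x|

end PiecewiseFamily

/-! ### A real RAM with access to random samples, and its operation count -/

/-- Memory of the machine: index registers (natural numbers), arrays of natural numbers, arrays of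
real numbers, and the number of samples drawn so far. A program mentions only finitely many
registers and arrays; array cells are addressed through registers. -/
structure State where
  reg : ℕ → ℕ
  natArr : ℕ → ℕ → ℕ
  realArr : ℕ → ℕ → ℝ
  drawn : ℕ

/-- Arithmetic on index registers (subtraction is truncated). -/
inductive NatOp
  | add | sub | mul

/-- Arithmetic on real numbers (with the convention `x / 0 = 0`). -/
inductive RealOp
  | add | sub | mul | div

def NatOp.eval : NatOp → ℕ → ℕ → ℕ
  | .add, x, y => x + y
  | .sub, x, y => x - y
  | .mul, x, y => x * y

def RealOp.eval : RealOp → ℝ → ℝ → ℝ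
  | .add, x, y => x + y
  | .sub, x, y => x - y
  | .mul, x, y => x * y
  | .div, x, y => x / y

/-- Elementary instructions. Letters `x y z` are names of registers, `A B C` names of arrays;
`A[x]` is the cell of `A` whose address is the content of register `x`. -/
inductive Instr
  /-- `x := v` for a fixed number `v` -/
  | const (x v : ℕ)
  /-- `x := y op z` -/
  | natOp (op : NatOp) (x y z : ℕ)
  /-- `x := A[y]`, for an array of natural numbers -/
  | natLoad (x A y : ℕ)
  /-- `A[x] := y`, for an array of natural numbers -/
  | natStore (A x y : ℕ)
  /-- `A[x] := y`, for an array of real numbers -/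
  | cast (A x y : ℕ)
  /-- `A[x] := B[y] op C[z]`, for arrays of real numbers -/
  | realOp (op : RealOp) (A x B y C z : ℕ)
  /-- `A[x] := |B[y]| ^ (1/z)`, for arrays of real numbers -/
  | root (A x B y z : ℕ)
  /-- draw a fresh sample `(w_0, …, w_d)` and put it into `A[x], A[x+1], …, A[x+d]` -/
  | sample (A x : ℕ)

/-- Tests: comparison of two registers, or of two cells of real arrays. -/
inductive Test
  | natLt (x y : ℕ)
  | realLt (A x B y : ℕ)

/-- Programs. -/
inductive Prog
  | instr (i : Instr)
  | seq (p q : Prog)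
  | ite (e : Test) (p q : Prog)
  | loop (e : Test) (p : Prog)

namespace State

def setReg (σ : State) (x v : ℕ) : State :=
  { σ with reg := Function.update σ.reg x v }

def setNat (σ : State) (A i v : ℕ) : State :=
  { σ with natArr := Function.update σ.natArr A (Function.update (σ.natArr A) i v) }

def setReal (σ : State) (A i : ℕ) (v : ℝ) : State :=
  { σ with realArr := Function.update σ.realArr A (Function.update (σ.realArr A) i v) }

/-- Write the vector `w` into the cells `i, …, i + d` of the real array `A`, and count one draw. -/
def putSample {d : ℕ} (σ : State) (A i : ℕ) (w : Fin (d + 1) → ℝ) : State :=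
  { σ with
    realArr := Function.update σ.realArr A
      (fun k => if h : i ≤ k ∧ k - i < d + 1 then w ⟨k - i, h.2⟩ else σ.realArr A k)
    drawn := σ.drawn + 1 }

end State

/-- Effect of an instruction; `w 0, w 1, …` is the stream of samples. -/
def Instr.run {d : ℕ} (w : ℕ → Fin (d + 1) → ℝ) (σ : State) : Instr → State
  | .const x v => σ.setReg x v
  | .natOp op x y z => σ.setReg x (op.eval (σ.reg y) (σ.reg z))
  | .natLoad x A y => σ.setReg x (σ.natArr A (σ.reg y))
  | .natStore A x y => σ.setNat A (σ.reg x) (σ.reg y)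
  | .cast A x y => σ.setReal A (σ.reg x) (σ.reg y : ℝ)
  | .realOp op A x B y C z =>
      σ.setReal A (σ.reg x) (op.eval (σ.realArr B (σ.reg y)) (σ.realArr C (σ.reg z)))
  | .root A x B y z =>
      σ.setReal A (σ.reg x) (|σ.realArr B (σ.reg y)| ^ (1 / (σ.reg z : ℝ)))
  | .sample A x => σ.putSample A (σ.reg x) (w σ.drawn)

/-- Number of operations of an instruction: a sample takes `T` operations, everything else one. -/
def Instr.cost (T : ℕ) : Instr → ℕ
  | .sample _ _ => T
  | _ => 1

def Test.Holds (σ : State) : Test → Prop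
  | .natLt x y => σ.reg x < σ.reg y
  | .realLt A x B y => σ.realArr A (σ.reg x) < σ.realArr B (σ.reg y)

/-- `Exec T w p σ σ' k`: with the stream of samples `w`, the program `p`, started in `σ`, halts in
`σ'` after exactly `k` operations. Every evaluation of a test is one operation. -/
inductive Exec {d : ℕ} (T : ℕ) (w : ℕ → Fin (d + 1) → ℝ) : Prog → State → State → ℕ → Prop
  | instr (i : Instr) (σ : State) : Exec T w (.instr i) σ (i.run w σ) (i.cost T)
  | seq {p q : Prog} {σ₁ σ₂ σ₃ : State} {k₁ k₂ : ℕ} :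
      Exec T w p σ₁ σ₂ k₁ → Exec T w q σ₂ σ₃ k₂ → Exec T w (.seq p q) σ₁ σ₃ (k₁ + k₂)
  | ite_true {e : Test} {p q : Prog} {σ₁ σ₂ : State} {k : ℕ} :
      e.Holds σ₁ → Exec T w p σ₁ σ₂ k → Exec T w (.ite e p q) σ₁ σ₂ (k + 1)
  | ite_false {e : Test} {p q : Prog} {σ₁ σ₂ : State} {k : ℕ} :
      ¬ e.Holds σ₁ → Exec T w q σ₁ σ₂ k → Exec T w (.ite e p q) σ₁ σ₂ (k + 1)
  | loop_done {e : Test} {p : Prog} {σ : State} :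
      ¬ e.Holds σ → Exec T w (.loop e p) σ σ 1
  | loop_step {e : Test} {p : Prog} {σ₁ σ₂ σ₃ : State} {k₁ k₂ : ℕ} :
      e.Holds σ₁ → Exec T w p σ₁ σ₂ k₁ → Exec T w (.loop e p) σ₂ σ₃ k₂ →
      Exec T w (.loop e p) σ₁ σ₃ (k₁ + k₂ + 1)

/-! ### Input and output conventions -/

namespace PiecewiseFamily

variable {d m n s : ℕ} (F : PiecewiseFamily d m n s)

/-- The initial state: registers `0, …, 4` hold `d, m, n, s, t`; the arrays of natural numbers
`0` and `1` hold the indices `b j ℓ` and `c j ℓ` at address `j * n + ℓ`; the arrays of real numbers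
`0`, `1`, `2` hold the endpoints, the coefficients `α j ℓ k` at address
`(j * n + ℓ) * (d + 1) + k`, and `ε, δ`. All other registers and cells are zero. -/
def initState (t : ℕ) (ε δ : ℝ) : State where
  reg := fun x =>
    match x with
    | 0 => d
    | 1 => m
    | 2 => n
    | 3 => s
    | 4 => t
    | _ => 0
  natArr := fun A i =>
    if h : i / n < m ∧ i % n < n then
      match A with
      | 0 => (F.b ⟨i / n, h.1⟩ ⟨i % n, h.2⟩ : ℕ)
      | 1 => (F.c ⟨i / n, h.1⟩ ⟨i % n, h.2⟩ : ℕ)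
      | _ => 0
    else 0
  realArr := fun A i =>
    match A with
    | 0 => if h : i < s then F.a ⟨i, h⟩ else 0
    | 1 =>
      if h : i / (d + 1) / n < m ∧ i / (d + 1) % n < n then
        F.α ⟨i / (d + 1) / n, h.1⟩ ⟨i / (d + 1) % n, h.2⟩
          ⟨i % (d + 1), Nat.mod_lt _ (Nat.succ_pos d)⟩
      else 0
    | 2 =>
      match i with
      | 0 => ε
      | 1 => δ
      | _ => 0
    | _ => 0
  drawn := 0

end PiecewiseFamily

/-- The computed estimate `D_{jk}` is read off cell `j * m + k` of the real array `3`. -/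
def State.output (σ : State) (m : ℕ) (j k : Fin m) : ℝ := σ.realArr 3 (j * m + k)

end CauchyL1

end

noncomputable section

namespace CauchyL1

/-! ### The Cauchy distribution: characteristic function and logarithmic moments -/

/-! Cauchy motion is 1-stable: the integral of a deterministic `f` against it has law `C(0, ‖f‖₁)`.
If all `f_j` are integrated against one and the same path, the difference of the integrals of `f_j`
and `f_k` is a Cauchy variable of scale exactly `‖f_j - f_k‖₁`. So `m` integrals per path serve all
`m²` pairs, and `t` independent paths give `t` independent copies for each pair.

Stability follows from the characteristic function `exp (-γ|t|)` (`charFun_cauchyMeasure`): it makes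
scales additive, and Riemann sums carry this over to `IsCI.map_pairing`. A path is assembled from
one sample of `CI_d(0,1)` per cell between consecutive endpoints, the cell being mapped affinely to
`[0,1]`. By `coe_sum_unitNorm_cellDiff` the scales of the cells add up to the distance, and by
`sketch_sub_sketch` the computed numbers are the required integrals.

The scale is estimated by the geometric mean of the absolute values. For a standard Cauchy variable
`X` the law of `log |X|` is symmetric, and `mgf_log_abs_cauchyMeasure_le` bounds its moment
generating function by `exp (2.8 l²)` for `|l| ≤ 1/2`. A Chernoff bound (`measure_geomMean_bad_le`)
gives failure probability at most `2 exp (-tε²/32)` per pair when `ε < 1`, and a union bound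
finishes. For `ε ≥ 1` the constant answer `2` is good enough, since two densities are at distance at
most `2`.

For the running time, a Taylor shift yields all moments of a cell in `O(d²)` operations, there are
at most `2mn` cells, and prefix sums reduce each piece to `O(d)` operations however many cells it
covers. Updating the products costs `O(m²)` per path. -/

lemma laplaceKernel_eqOn_Iic (x : ℝ) :
    EqOn (fun v : ℝ => Complex.exp (↑(-2 * Real.pi * inner ℝ v x) * Complex.I) •
      Complex.exp ((-2 * Real.pi * |v| : ℝ) : ℂ))
      (fun v : ℝ => Complex.exp ((2 * Real.pi * (1 - x * Complex.I)) * v)) (Iic 0) := by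
  intro v hv
  simp only [smul_eq_mul, ← Complex.exp_add, abs_of_nonpos (mem_Iic.1 hv)]
  congr 1
  simp only [RCLike.inner_apply, conj_trivial]
  push_cast
  ring

lemma laplaceKernel_eqOn_Ioi (x : ℝ) :
    EqOn (fun v : ℝ => Complex.exp (↑(-2 * Real.pi * inner ℝ v x) * Complex.I) •
      Complex.exp ((-2 * Real.pi * |v| : ℝ) : ℂ))
      (fun v : ℝ => Complex.exp ((-2 * Real.pi * (1 + x * Complex.I)) * v)) (Ioi 0) := by
  intro v hv
  simp only [smul_eq_mul, ← Complex.exp_add, abs_of_pos (mem_Ioi.1 hv)]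
  congr 1
  simp only [RCLike.inner_apply, conj_trivial]
  push_cast
  ring

lemma integrableOn_laplaceKernel_Iic (x : ℝ) :
    IntegrableOn (fun v : ℝ => Complex.exp (↑(-2 * Real.pi * inner ℝ v x) * Complex.I) •
      Complex.exp ((-2 * Real.pi * |v| : ℝ) : ℂ)) (Iic 0) := by
  rw [integrableOn_congr_fun (laplaceKernel_eqOn_Iic x) measurableSet_Iic]
  exact integrableOn_exp_mul_complex_Iic (by simp [Real.pi_pos]) 0

lemma integrableOn_laplaceKernel_Ioi (x : ℝ) :
    IntegrableOn (fun v : ℝ => Complex.exp (↑(-2 * Real.pi * inner ℝ v x) * Complex.I) •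
      Complex.exp ((-2 * Real.pi * |v| : ℝ) : ℂ)) (Ioi 0) := by
  rw [integrableOn_congr_fun (laplaceKernel_eqOn_Ioi x) measurableSet_Ioi]
  exact integrableOn_exp_mul_complex_Ioi (by simp [Real.pi_pos]) 0

lemma integrable_exp_neg_two_pi_abs :
    Integrable (fun x : ℝ => Complex.exp ((-2 * Real.pi * |x| : ℝ) : ℂ)) := by
  have h := (integrableOn_laplaceKernel_Iic 0).union (integrableOn_laplaceKernel_Ioi 0)
  rw [Iic_union_Ioi, integrableOn_univ] at h
  simpa using h

lemma fourier_exp_neg_two_pi_abs :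
    FourierTransform.fourier (fun x : ℝ => Complex.exp ((-2 * Real.pi * |x| : ℝ) : ℂ)) =
      fun x : ℝ => ((Real.pi⁻¹ * (1 + x ^ 2)⁻¹ : ℝ) : ℂ) := by
  funext x
  rw [Real.fourier_eq', ← intervalIntegral.integral_Iic_add_Ioi (integrableOn_laplaceKernel_Iic x)
    (integrableOn_laplaceKernel_Ioi x),
    setIntegral_congr_fun measurableSet_Iic (laplaceKernel_eqOn_Iic x),
    setIntegral_congr_fun measurableSet_Ioi (laplaceKernel_eqOn_Ioi x),
    integral_exp_mul_complex_Iic (by simp [Real.pi_pos]),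
    integral_exp_mul_complex_Ioi (by simp [Real.pi_pos])]
  have hpi : (Real.pi : ℂ) ≠ 0 := by exact_mod_cast Real.pi_ne_zero
  have h1 : (1 - x * Complex.I : ℂ) ≠ 0 := by
    intro h
    simpa using congrArg Complex.re h
  have h2 : (1 + x * Complex.I : ℂ) ≠ 0 := by
    intro h
    simpa using congrArg Complex.re h
  have h3 : (1 + x ^ 2 : ℂ) = (1 - x * Complex.I) * (1 + x * Complex.I) := by
    linear_combination (x : ℂ) ^ 2 * Complex.I_sq
  push_cast
  rw [h3]
  simp only [mul_zero, Complex.exp_zero]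
  field_simp
  ring_nf

/-- Fourier inversion for `exp (-2π|x|)`, evaluated at `t / (2π)`. It holds pointwise because the
function is continuous and both it and its transform are integrable. -/
lemma integral_cexp_mul_inv_one_add_sq (t : ℝ) :
    ∫ x : ℝ, Complex.exp (t * x * Complex.I) * ((Real.pi⁻¹ * (1 + x ^ 2)⁻¹ : ℝ) : ℂ) =
      Complex.exp ((-|t| : ℝ) : ℂ) := by
  have hcont : Continuous (fun x : ℝ => Complex.exp ((-2 * Real.pi * |x| : ℝ) : ℂ)) := by
    fun_prop
  have hF : Integrable (FourierTransform.fourier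
      (fun x : ℝ => Complex.exp ((-2 * Real.pi * |x| : ℝ) : ℂ))) := by
    rw [fourier_exp_neg_two_pi_abs]
    exact (integrable_inv_one_add_sq.const_mul _).ofReal
  have h := congrFun (hcont.fourierInv_fourier_eq integrable_exp_neg_two_pi_abs hF)
    (t / (2 * Real.pi))
  rw [fourier_exp_neg_two_pi_abs, Real.fourierInv_eq'] at h
  have hpi := Real.pi_pos
  convert h using 1
  · refine integral_congr_ae (Eventually.of_forall fun x => ?_)
    simp only [smul_eq_mul, RCLike.inner_apply, conj_trivial]
    congr 3
    norm_cast
    field_simp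
  · congr 2
    rw [abs_div, abs_of_pos (show 0 < 2 * Real.pi by positivity)]
    field_simp

lemma integral_cauchyMeasure {E : Type*} [NormedAddCommGroup E] [NormedSpace ℝ E]
    {γ : NNReal} (hγ : γ ≠ 0) (g : ℝ → E) :
    ∫ x, g x ∂(cauchyMeasure 0 γ) = ∫ x, (Real.pi⁻¹ * (1 + x ^ 2)⁻¹) • g (γ * x) := by
  rw [cauchyMeasure_of_scale_ne_zero 0 hγ,
    integral_withDensity_eq_integral_toReal_smul (measurable_cauchyPDF 0 γ)
      (Eventually.of_forall fun x => by simp [cauchyPDF])]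
  have hγ' : (0 : ℝ) < γ := by positivity
  have h := Measure.integral_comp_mul_left
    (fun x => ((cauchyPDF 0 γ x).toReal * γ) • g x) (γ : ℝ)
  rw [abs_of_pos (inv_pos.2 hγ')] at h
  have h2 : ∫ x, ((cauchyPDF 0 γ x).toReal * γ) • g x =
      (γ : ℝ) • ∫ x, (cauchyPDF 0 γ x).toReal • g x := by
    rw [← integral_smul]
    congr 1
    funext x
    rw [smul_smul, mul_comm]
  rw [h2, smul_smul, inv_mul_cancel₀ hγ'.ne', one_smul] at h
  rw [← h]
  congr 1
  funext x
  rw [cauchyPDF, ENNReal.toReal_ofReal (cauchyPDF_pos 0 hγ _).le, cauchyPDFReal_def']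
  have hx : (γ * x - 0) / (γ : ℝ) = x := by field_simp; simp
  rw [hx, NNReal.coe_inv]
  congr 1
  field_simp

lemma charFun_cauchyMeasure (γ : NNReal) (t : ℝ) :
    charFun (cauchyMeasure 0 γ) t = Complex.exp ((-(γ * |t|) : ℝ) : ℂ) := by
  by_cases hγ : γ = 0
  · simp [hγ]
  rw [charFun_apply_real, integral_cauchyMeasure hγ]
  have h := integral_cexp_mul_inv_one_add_sq (t * γ)
  rw [abs_mul, abs_of_nonneg γ.coe_nonneg, mul_comm |t|] at h
  rw [← h]
  congr 1
  funext x
  rw [Complex.real_smul, mul_comm]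
  congr 3
  push_cast
  ring

/-- Termwise comparison of power series: `θ^(2n) ≤ θ²` for every `n ≥ 1`. This turns a bound on one
exponential moment into a quadratic bound near `0`. -/
lemma cosh_mul_le {θ : ℝ} (hθ : |θ| ≤ 1) (z : ℝ) :
    Real.cosh (θ * z) ≤ 1 + θ ^ 2 * (Real.cosh z - 1) := by
  have hθ2 : θ ^ 2 ≤ 1 := (sq_le_one_iff_abs_le_one θ).2 hθ
  have h1 : HasSum (fun n : ℕ => (if n = 0 then 1 - θ ^ 2 else 0) +
      θ ^ 2 * (z ^ (2 * n) / ((2 * n).factorial : ℝ)))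
      ((1 - θ ^ 2) + θ ^ 2 * Real.cosh z) :=
    (hasSum_ite_eq 0 (1 - θ ^ 2)).add ((Real.hasSum_cosh z).mul_left _)
  have h2 := hasSum_le (fun n => ?_) (Real.hasSum_cosh (θ * z)) h1
  · linarith
  · rcases n with _ | n
    · simp
    · simp only [Nat.add_eq_zero_iff, one_ne_zero, and_false, if_false, zero_add]
      rw [mul_pow, mul_div_assoc]
      refine mul_le_mul_of_nonneg_right ?_ ?_
      · rw [pow_mul, pow_succ]
        exact mul_le_of_le_one_left (sq_nonneg θ) (pow_le_one₀ (sq_nonneg θ) hθ2)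
      · rw [pow_mul]
        positivity

lemma exp_mul_log_le_of_le_one {l x : ℝ} (hl : |l| ≤ 1 / 2) (hx : 0 < x) (hx1 : x ≤ 1) :
    Real.exp (l * Real.log x) * (1 + x ^ 2)⁻¹ ≤ x ^ (-(1 / 2) : ℝ) := by
  rw [Real.rpow_def_of_pos hx, mul_comm l]
  have h1 : (1 + x ^ 2)⁻¹ ≤ 1 := inv_le_one_of_one_le₀ (by nlinarith [sq_nonneg x])
  refine (mul_le_of_le_one_right (Real.exp_pos _).le h1).trans (Real.exp_le_exp.2 ?_)
  exact mul_le_mul_of_nonpos_left (by linarith [abs_le.1 hl]) (Real.log_nonpos hx.le hx1)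

lemma exp_mul_log_le_of_one_le {l x : ℝ} (hl : |l| ≤ 1 / 2) (hx1 : 1 ≤ x) :
    Real.exp (l * Real.log x) * (1 + x ^ 2)⁻¹ ≤ x ^ (-(3 / 2) : ℝ) := by
  have hx : 0 < x := by linarith
  have h1 : (1 + x ^ 2)⁻¹ ≤ x ^ (-2 : ℝ) := by
    rw [Real.rpow_neg hx.le, Real.rpow_ofNat]
    exact inv_anti₀ (by positivity) (by linarith)
  have h2 : Real.exp (l * Real.log x) ≤ x ^ (1 / 2 : ℝ) := by
    rw [Real.rpow_def_of_pos hx, mul_comm l]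
    exact Real.exp_le_exp.2
      (mul_le_mul_of_nonneg_left (by linarith [abs_le.1 hl]) (Real.log_nonneg hx1))
  calc _ ≤ x ^ (1 / 2 : ℝ) * x ^ (-2 : ℝ) := by gcongr
    _ = _ := by rw [← Real.rpow_add hx]; norm_num

lemma integrableOn_exp_mul_log_Ioi {l : ℝ} (hl : |l| ≤ 1 / 2) :
    IntegrableOn (fun x : ℝ => Real.exp (l * Real.log x) * (1 + x ^ 2)⁻¹) (Ioi 0) := by
  have hm : Measurable (fun x : ℝ => Real.exp (l * Real.log x) * (1 + x ^ 2)⁻¹) := by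
    fun_prop
  rw [← Ioc_union_Ioi_eq_Ioi zero_le_one]
  refine IntegrableOn.union ?_ ?_
  · have h : IntegrableOn (fun x : ℝ => x ^ (-(1 / 2) : ℝ)) (Ioc 0 1) := by
      rw [← intervalIntegrable_iff_integrableOn_Ioc_of_le zero_le_one]
      exact intervalIntegral.intervalIntegrable_rpow' (by norm_num)
    refine Integrable.mono' h hm.aestronglyMeasurable ?_
    filter_upwards [ae_restrict_mem measurableSet_Ioc] with x hx
    rw [Real.norm_of_nonneg (by positivity)]
    exact exp_mul_log_le_of_le_one hl hx.1 hx.2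
  · have h : IntegrableOn (fun x : ℝ => x ^ (-(3 / 2) : ℝ)) (Ioi 1) :=
      integrableOn_Ioi_rpow_of_lt (by norm_num) one_pos
    refine Integrable.mono' h hm.aestronglyMeasurable ?_
    filter_upwards [ae_restrict_mem measurableSet_Ioi] with x hx
    rw [Real.norm_of_nonneg (by positivity)]
    exact exp_mul_log_le_of_one_le hl (le_of_lt hx)

/-- The integrand is at most `x^(1/2)` on `(0,1]` and at most `x^(-3/2)` beyond `1`, which gives
`2/3 + 2`. -/
lemma integral_exp_half_log_le :
    ∫ x in Ioi (0 : ℝ), Real.exp (1 / 2 * Real.log x) * (1 + x ^ 2)⁻¹ ≤ 8 / 3 := by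
  have hl : |(1 / 2 : ℝ)| ≤ 1 / 2 := by norm_num [abs_of_pos]
  have hi := integrableOn_exp_mul_log_Ioi hl
  rw [← Ioc_union_Ioi_eq_Ioi zero_le_one] at hi ⊢
  rw [setIntegral_union (Ioc_disjoint_Ioi le_rfl) measurableSet_Ioi hi.left_of_union
    hi.right_of_union]
  have h1 : ∫ x in Ioc (0 : ℝ) 1, Real.exp (1 / 2 * Real.log x) * (1 + x ^ 2)⁻¹ ≤ 2 / 3 := by
    have h : ∫ x in Ioc (0 : ℝ) 1, x ^ (1 / 2 : ℝ) = 2 / 3 := by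
      rw [← intervalIntegral.integral_of_le zero_le_one, integral_rpow (by norm_num)]
      norm_num
    rw [← h]
    refine setIntegral_mono_on hi.left_of_union ?_ measurableSet_Ioc fun x hx => ?_
    · rw [← intervalIntegrable_iff_integrableOn_Ioc_of_le zero_le_one]
      exact intervalIntegral.intervalIntegrable_rpow' (by norm_num)
    · rw [Real.rpow_def_of_pos hx.1, mul_comm (1 / 2 : ℝ)]
      exact mul_le_of_le_one_right (Real.exp_pos _).le
        (inv_le_one_of_one_le₀ (by nlinarith [sq_nonneg x]))
  have h2 : ∫ x in Ioi (1 : ℝ), Real.exp (1 / 2 * Real.log x) * (1 + x ^ 2)⁻¹ ≤ 2 := by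
    have h : ∫ x in Ioi (1 : ℝ), x ^ (-(3 / 2) : ℝ) = 2 := by
      rw [integral_Ioi_rpow_of_lt (by norm_num) one_pos]
      norm_num
    refine le_of_le_of_eq ?_ h
    exact setIntegral_mono_on hi.right_of_union
      (integrableOn_Ioi_rpow_of_lt (by norm_num) one_pos) measurableSet_Ioi
      fun x hx => exp_mul_log_le_of_one_le hl (le_of_lt hx)
  linarith

/-- The substitution `x ↦ 1/x` preserves `dx / (1 + x²)` and changes the sign of `log x`. -/
lemma integral_exp_neg_mul_log (l : ℝ) :
    ∫ x in Ioi (0 : ℝ), Real.exp (-l * Real.log x) * (1 + x ^ 2)⁻¹ =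
      ∫ x in Ioi (0 : ℝ), Real.exp (l * Real.log x) * (1 + x ^ 2)⁻¹ := by
  rw [← integral_comp_rpow_Ioi (fun x : ℝ => Real.exp (l * Real.log x) * (1 + x ^ 2)⁻¹)
    (p := -1) (by norm_num)]
  refine setIntegral_congr_fun measurableSet_Ioi fun x hx => ?_
  have hx : 0 < x := hx
  have h2 : x ^ (-1 - 1 : ℝ) = (x ^ 2)⁻¹ := by
    rw [show (-1 - 1 : ℝ) = -2 by norm_num, Real.rpow_neg hx.le, Real.rpow_ofNat]
  simp only [Real.rpow_neg_one, Real.log_inv, smul_eq_mul, h2, abs_neg, abs_one]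
  rw [show l * -Real.log x = -l * Real.log x by ring]
  field_simp
  ring_nf

/-- By the symmetry under `x ↦ 1/x` the exponential may be replaced by `cosh (l log x)`, which has
no linear term in `l`. Then `cosh_mul_le` with `θ = 2l` interpolates between the exponents `0` and
`1/2`, where the integrals are known or bounded. -/
lemma integral_exp_mul_log_le {l : ℝ} (hl : |l| ≤ 1 / 2) :
    ∫ x in Ioi (0 : ℝ), Real.exp (l * Real.log x) * (1 + x ^ 2)⁻¹ ≤
      Real.pi / 2 * (1 + 2.8 * l ^ 2) := by
  have key : ∀ u : ℝ, |u| ≤ 1 / 2 →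
      IntegrableOn (fun x : ℝ => Real.cosh (u * Real.log x) * (1 + x ^ 2)⁻¹) (Ioi 0) ∧
      ∫ x in Ioi (0 : ℝ), Real.cosh (u * Real.log x) * (1 + x ^ 2)⁻¹ =
        ∫ x in Ioi (0 : ℝ), Real.exp (u * Real.log x) * (1 + x ^ 2)⁻¹ := by
    intro u hu
    have h1 := integrableOn_exp_mul_log_Ioi hu
    have h2 := integrableOn_exp_mul_log_Ioi (l := -u) (by rwa [abs_neg])
    have h3 : (fun x : ℝ => Real.cosh (u * Real.log x) * (1 + x ^ 2)⁻¹) = fun x : ℝ =>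
        1 / 2 * (Real.exp (u * Real.log x) * (1 + x ^ 2)⁻¹ +
          Real.exp (-u * Real.log x) * (1 + x ^ 2)⁻¹) := by
      funext x
      rw [Real.cosh_eq, neg_mul]
      ring
    rw [h3]
    refine ⟨(h1.add h2).const_mul _, ?_⟩
    rw [integral_const_mul, integral_add h1 h2, integral_exp_neg_mul_log]
    ring
  have hhalf : |(1 / 2 : ℝ)| ≤ 1 / 2 := by norm_num [abs_of_pos]
  rw [← (key l hl).2]
  have hone : ∫ x in Ioi (0 : ℝ), (1 + x ^ 2)⁻¹ = Real.pi / 2 := by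
    simp
  have hle : ∫ x in Ioi (0 : ℝ), Real.cosh (l * Real.log x) * (1 + x ^ 2)⁻¹ ≤
      ∫ x in Ioi (0 : ℝ), ((1 - 4 * l ^ 2) * (1 + x ^ 2)⁻¹ +
        4 * l ^ 2 * (Real.cosh (1 / 2 * Real.log x) * (1 + x ^ 2)⁻¹)) := by
    refine integral_mono (key l hl).1 ?_ fun x => ?_
    · exact (integrable_inv_one_add_sq.integrableOn.const_mul _).add
        ((key (1 / 2) hhalf).1.const_mul _)
    · have h := cosh_mul_le (θ := 2 * l) (by rw [abs_mul, abs_two]; linarith)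
        (1 / 2 * Real.log x)
      rw [show 2 * l * (1 / 2 * Real.log x) = l * Real.log x by ring] at h
      have h2 : (0 : ℝ) ≤ (1 + x ^ 2)⁻¹ := by positivity
      have h3 := mul_le_mul_of_nonneg_right h h2
      dsimp only
      linarith
  refine hle.trans ?_
  rw [integral_add (integrable_inv_one_add_sq.integrableOn.const_mul _)
    ((key (1 / 2) hhalf).1.const_mul _), integral_const_mul, integral_const_mul, hone,
    (key (1 / 2) hhalf).2]
  have h4 := integral_exp_half_log_le
  -- After cancelling `π/2`, the coefficients of `l²` require `32/3 ≤ 3.4 π`. This is the origin of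
  -- the constant `2.8`, and it leaves little room.
  nlinarith [Real.pi_gt_d4, sq_nonneg l, mul_le_mul_of_nonneg_left h4 (sq_nonneg l)]

lemma integrable_exp_mul_log_abs {l : ℝ} (hl : |l| ≤ 1 / 2) :
    Integrable (fun x => Real.exp (l * Real.log |x|)) (cauchyMeasure 0 1) := by
  have h := integrableOn_exp_mul_log_Ioi hl
  have h2 : Integrable (fun x : ℝ => Real.exp (l * Real.log |x|) * (1 + |x| ^ 2)⁻¹) := by
    have hpos : IntegrableOn
        (fun x : ℝ => Real.exp (l * Real.log |x|) * (1 + |x| ^ 2)⁻¹) (Ioi 0) := by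
      refine h.congr_fun (fun x hx => ?_) measurableSet_Ioi
      simp [abs_of_pos (mem_Ioi.1 hx)]
    have hneg : IntegrableOn
        (fun x : ℝ => Real.exp (l * Real.log |x|) * (1 + |x| ^ 2)⁻¹) (Iic 0) := by
      rw [← Measure.map_neg_eq_self (volume : Measure ℝ)]
      have m : MeasurableEmbedding (Neg.neg : ℝ → ℝ) := (Homeomorph.neg ℝ).measurableEmbedding
      rw [m.integrableOn_map_iff]
      simpa [Function.comp_def, integrableOn_Ici_iff_integrableOn_Ioi] using hpos
    rw [← integrableOn_univ, ← Iic_union_Ioi (a := (0 : ℝ))]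
    exact hneg.union hpos
  rw [cauchyMeasure_of_scale_ne_zero 0 one_ne_zero,
    integrable_withDensity_iff_integrable_smul' (measurable_cauchyPDF 0 1)
      (Eventually.of_forall fun x => by simp [cauchyPDF])]
  refine (h2.const_mul Real.pi⁻¹).congr (Eventually.of_forall fun x => ?_)
  have hx : (cauchyPDF 0 1 x).toReal = Real.pi⁻¹ * (1 + |x| ^ 2)⁻¹ := by
    rw [cauchyPDF, ENNReal.toReal_ofReal (cauchyPDF_pos 0 one_ne_zero _).le, cauchyPDFReal_def']
    simp
  simp only [hx, smul_eq_mul]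
  ring

lemma mgf_log_abs_cauchyMeasure_le {l : ℝ} (hl : |l| ≤ 1 / 2) :
    mgf (fun x => Real.log |x|) (cauchyMeasure 0 1) l ≤ Real.exp (2.8 * l ^ 2) := by
  have h := integral_exp_mul_log_le hl
  have h2 := integral_comp_abs (f := fun x : ℝ => Real.exp (l * Real.log x) * (1 + x ^ 2)⁻¹)
  rw [mgf, integral_cauchyMeasure one_ne_zero]
  have h3 : ∫ x : ℝ, (Real.pi⁻¹ * (1 + x ^ 2)⁻¹) •
      Real.exp (l * Real.log |((1 : NNReal) : ℝ) * x|) =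
      Real.pi⁻¹ * ∫ x : ℝ, Real.exp (l * Real.log |x|) * (1 + |x| ^ 2)⁻¹ := by
    rw [← integral_const_mul]
    congr 1
    funext x
    simp
    ring
  rw [h3, h2]
  have hpi := Real.pi_pos
  calc _ ≤ Real.pi⁻¹ * (2 * (Real.pi / 2 * (1 + 2.8 * l ^ 2))) := by gcongr
    _ = 2.8 * l ^ 2 + 1 := by field_simp; ring
    _ ≤ _ := Real.add_one_le_exp _

/-! ### Sums of independent Cauchy variables -/

lemma map_const_mul_cauchyMeasure (c : ℝ) (γ : NNReal) :
    (cauchyMeasure 0 γ).map (fun x => c * x) = cauchyMeasure 0 (Real.nnabs c * γ) := by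
  have : IsProbabilityMeasure ((cauchyMeasure 0 γ).map (fun x => c * x)) :=
    Measure.isProbabilityMeasure_map (by fun_prop)
  refine Measure.ext_of_charFun ?_
  funext t
  rw [charFun_map_mul, charFun_cauchyMeasure, charFun_cauchyMeasure, abs_mul]
  push_cast
  congr 1
  simp
  ring

lemma map_sum_eq_cauchyMeasure {Ω ι : Type*} [MeasurableSpace Ω] {P : Measure Ω} [Fintype ι]
    {X : ι → Ω → ℝ} {γ : ι → NNReal} (hX : iIndepFun X P)
    (hm : ∀ i, AEMeasurable (X i) P) (hl : ∀ i, P.map (X i) = cauchyMeasure 0 (γ i)) :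
    P.map (fun ω => ∑ i, X i ω) = cauchyMeasure 0 (∑ i, γ i) := by
  have := hX.isProbabilityMeasure
  have : IsProbabilityMeasure (P.map (fun ω => ∑ i, X i ω)) :=
    Measure.isProbabilityMeasure_map (Finset.aemeasurable_fun_sum _ fun i _ => hm i)
  refine Measure.ext_of_charFun ?_
  rw [hX.charFun_map_fun_sum_eq_prod hm]
  funext t
  simp only [Finset.prod_apply, hl, charFun_cauchyMeasure]
  rw [← Complex.exp_sum]
  push_cast
  simp [Finset.sum_mul]

/-! ### Integrals of polynomials against Cauchy motion -/

/-- The linear functional that sends the monomials `1, x, …, x^d` to the entries of `w`. -/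
def pairing {d : ℕ} (w : Fin (d + 1) → ℝ) (p : Polynomial ℝ) : ℝ :=
  ∑ k : Fin (d + 1), p.coeff k * w k

/-- `∫_0^1 |p|`. -/
def unitNorm (p : Polynomial ℝ) : NNReal := Real.toNNReal (∫ x in (0 : ℝ)..1, |p.eval x|)

lemma measurable_pairing {d : ℕ} (p : Polynomial ℝ) :
    Measurable (fun w : Fin (d + 1) → ℝ => pairing w p) := by
  unfold pairing
  fun_prop

/-- Mean value theorem for integrals. With such tags the Riemann sums of `|p|` equal its integral,
so Riemann sums of `p` against Cauchy motion have the limiting law exactly and no limit of scales is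
needed. -/
lemma exists_tag_integral_abs (p : Polynomial ℝ) {u v : ℝ} (huv : u < v) :
    ∃ c, u ≤ c ∧ c ≤ v ∧ (v - u) * |p.eval c| = ∫ x in u..v, |p.eval x| := by
  obtain ⟨c, hc, h⟩ := exists_eq_interval_average (f := fun x => |p.eval x|) huv.ne
    (by fun_prop)
  rw [uIoo_of_le huv.le] at hc
  refine ⟨c, hc.1.le, hc.2.le, ?_⟩
  have h0 : v - u ≠ 0 := (sub_pos.2 huv).ne'
  rw [h, interval_average_eq_div]
  field_simp

lemma IsCauchyMotion.map_riemannSum {Ω : Type*} [MeasurableSpace Ω] {P : Measure Ω}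
    {L : ℝ → Ω → ℝ} (hL : IsCauchyMotion P L) {x : ℕ → ℝ} (hx : Monotone x) (c : ℕ → ℝ)
    (N : ℕ) :
    P.map (fun ω => ∑ i ∈ Finset.range N, c i * (L (x (i + 1)) ω - L (x i) ω)) =
      cauchyMeasure 0 (∑ i ∈ Finset.range N, Real.nnabs (c i) * Real.nnabs (x (i + 1) - x i)) := by
  have hm : ∀ i : ℕ, Measurable (fun ω => L (x (i + 1)) ω - L (x i) ω) := fun i =>
    (hL.measurable _).sub (hL.measurable _)
  have hind := hL.indep.nat hx
  have hind2 : iIndepFun (fun (i : Fin N) ω => c i * (L (x (i + 1)) ω - L (x i) ω)) P :=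
    (hind.precomp Fin.val_injective).comp (fun i y => c i * y) (fun i => by fun_prop)
  simp_rw [Finset.sum_range]
  refine map_sum_eq_cauchyMeasure hind2 (fun i => ((hm i).const_mul _).aemeasurable) fun i => ?_
  rw [← map_const_mul_cauchyMeasure, ← (hL.law (x i) (x (i + 1))).map_eq,
    Measure.map_map (by fun_prop) (hm i)]
  rfl

lemma norm_cexp_mul_I_sub_le (a b : ℝ) :
    ‖Complex.exp (a * Complex.I) - Complex.exp (b * Complex.I)‖ ≤ |a - b| := by
  have h : Complex.exp (a * Complex.I) - Complex.exp (b * Complex.I) =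
      Complex.exp (b * Complex.I) * (Complex.exp (Complex.I * ((a - b : ℝ) : ℂ)) - 1) := by
    rw [mul_sub, ← Complex.exp_add, mul_one]
    congr 2
    push_cast
    ring
  rw [h, norm_mul, Complex.norm_exp_ofReal_mul_I, one_mul]
  exact Real.norm_exp_I_mul_ofReal_sub_one_le

/-- Where `U` and `V` are within `r`, the exponentials differ by at most `|t| r`; on the exceptional
event they differ by at most `2`. -/
lemma norm_charFun_sub_le {Ω : Type*} [MeasurableSpace Ω] {P : Measure Ω}
    [IsProbabilityMeasure P] {U V : Ω → ℝ} (hU : AEMeasurable U P) (hV : AEMeasurable V P)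
    (t : ℝ) {r ρ : ℝ} (hr : 0 ≤ r) (hρ : 0 ≤ ρ)
    (h : P {ω | r < |U ω - V ω|} ≤ ENNReal.ofReal ρ) :
    ‖charFun (P.map U) t - charFun (P.map V) t‖ ≤ |t| * r + 2 * ρ := by
  have hexp : ∀ {W : Ω → ℝ}, AEMeasurable W P →
      charFun (P.map W) t = ∫ ω, Complex.exp (((t * W ω : ℝ) : ℂ) * Complex.I) ∂P ∧
      Integrable (fun ω => Complex.exp (((t * W ω : ℝ) : ℂ) * Complex.I)) P := by
    intro W hW
    have hmeas : AEStronglyMeasurable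
        (fun ω => Complex.exp (((t * W ω : ℝ) : ℂ) * Complex.I)) P :=
      (by fun_prop : AEMeasurable _ P).aestronglyMeasurable
    constructor
    · rw [charFun_apply_real, integral_map hW (by fun_prop)]
      simp
    · refine Integrable.of_bound hmeas 1 (Eventually.of_forall fun ω => ?_)
      rw [Complex.norm_exp_ofReal_mul_I]
  rw [(hexp hU).1, (hexp hV).1, ← integral_sub (hexp hU).2 (hexp hV).2]
  set B := toMeasurable P {ω | r < |U ω - V ω|}
  have hB : MeasurableSet B := measurableSet_toMeasurable _ _
  have hPB : P.real B ≤ ρ := by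
    rw [Measure.real, measure_toMeasurable]
    exact ENNReal.toReal_le_of_le_ofReal hρ h
  have hind : Integrable (B.indicator (1 : Ω → ℝ)) P := (integrable_const (1 : ℝ)).indicator hB
  have hint : Integrable (fun ω => |t| * r + 2 * B.indicator (1 : Ω → ℝ) ω) P :=
    (integrable_const _).add (hind.const_mul 2)
  refine (norm_integral_le_of_norm_le hint (Eventually.of_forall fun ω => ?_)).trans ?_
  · by_cases hω : ω ∈ B
    · have h2 : ‖Complex.exp (((t * U ω : ℝ) : ℂ) * Complex.I) -
          Complex.exp (((t * V ω : ℝ) : ℂ) * Complex.I)‖ ≤ 1 + 1 := by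
        refine (norm_sub_le _ _).trans ?_
        rw [Complex.norm_exp_ofReal_mul_I, Complex.norm_exp_ofReal_mul_I]
      have h3 : 0 ≤ |t| * r := by positivity
      simp only [hω, indicator_of_mem, Pi.one_apply]
      linarith
    · have h2 : |U ω - V ω| ≤ r := by
        by_contra hc
        exact hω (subset_toMeasurable P _ (not_le.1 hc))
      refine (norm_cexp_mul_I_sub_le _ _).trans ?_
      rw [← mul_sub, abs_mul]
      simp only [hω, not_false_eq_true, indicator_of_notMem, mul_zero, add_zero]
      gcongr
  · rw [integral_add (integrable_const _) (hind.const_mul 2), integral_const_mul,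
      integral_const_mul, integral_indicator_one hB]
    simp only [integral_const, probReal_univ, smul_eq_mul, one_mul]
    linarith

/-- By linearity the pairing is the limit in probability of Riemann sums of `p`. For suitable tags
these all have law `C(0, ∫|p|)`, so the characteristic functions differ by at most `C * η` for every
`η > 0`. -/
theorem IsCI.map_pairing {d : ℕ} {μ : Measure (Fin (d + 1) → ℝ)} (h : IsCI d 0 1 μ)
    {p : Polynomial ℝ} (hp : p.natDegree ≤ d) :
    μ.map (fun w => pairing w p) = cauchyMeasure 0 (unitNorm p) := by
  obtain ⟨Ω, _, P, L, Z, hP, hL, hZ, hlaw⟩ := h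
  have hZm := hlaw.aemeasurable
  rw [← hlaw.map_eq, AEMeasurable.map_map_of_aemeasurable (measurable_pairing p).aemeasurable hZm]
  have hVm : AEMeasurable ((fun w => pairing w p) ∘ Z) P :=
    (measurable_pairing p).comp_aemeasurable hZm
  have : IsProbabilityMeasure (P.map ((fun w => pairing w p) ∘ Z)) :=
    Measure.isProbabilityMeasure_map hVm
  refine Measure.ext_of_charFun ?_
  funext t
  set C : ℝ := |t| * (∑ k : Fin (d + 1), |p.coeff k|) + 2 * (d + 1)
  have hC : 0 < C := by positivity
  have key : ∀ η : ℝ, 0 < η →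
      ‖charFun (cauchyMeasure 0 (unitNorm p)) t -
        charFun (P.map ((fun w => pairing w p) ∘ Z)) t‖ ≤ C * η := by
    intro η hη
    choose ρ hρ hR using fun k => hZ k η hη
    obtain ⟨M, hM⟩ : ∃ M : ℕ, ∀ k, 1 / ((M : ℝ) + 1) ≤ ρ k := by
      choose M hM using fun k => exists_nat_one_div_lt (hρ k)
      refine ⟨Finset.univ.sup M, fun k => (one_div_le_one_div_of_le (by positivity) ?_).trans
        (hM k).le⟩
      have : M k ≤ Finset.univ.sup M := Finset.le_sup (Finset.mem_univ k)
      gcongr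
    set N := M + 1
    have hN : (0 : ℝ) < N := by positivity
    set x : ℕ → ℝ := fun i => i / N with hxdef
    have hstep : ∀ i, x (i + 1) - x i = 1 / N := fun i => by
      simp only [hxdef]; push_cast; ring
    have hlt : ∀ i, x i < x (i + 1) := fun i => by
      have := hstep i
      have : (0 : ℝ) < 1 / N := by positivity
      linarith
    -- One partition and one choice of tags serve all monomials, so that their Riemann sums combine
    -- linearly to the Riemann sum of `p`.
    choose ξ hξ1 hξ2 hξ using fun i => exists_tag_integral_abs p (hlt i)
    have hmap := hL.map_riemannSum (monotone_nat_of_le_succ fun i => (hlt i).le)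
      (fun i => p.eval (ξ i)) N
    have hx0 : x 0 = 0 := by simp [hxdef]
    have hxN : x N = 1 := by simp [hxdef, hN.ne']
    have hγ : ∑ i ∈ Finset.range N, Real.nnabs (p.eval (ξ i)) * Real.nnabs (x (i + 1) - x i) =
        unitNorm p := by
      have h1 : ∑ i ∈ Finset.range N, ∫ y in x i..x (i + 1), |p.eval y| =
          ∫ y in (0 : ℝ)..1, |p.eval y| := by
        rw [intervalIntegral.sum_integral_adjacent_intervals, hx0, hxN]
        intro i _
        exact (by fun_prop : Continuous fun y => |p.eval y|).intervalIntegrable _ _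
      rw [unitNorm, ← h1]
      ext
      rw [Real.coe_toNNReal _ (Finset.sum_nonneg fun i _ =>
        intervalIntegral.integral_nonneg (hlt i).le fun _ _ => abs_nonneg _)]
      push_cast
      refine Finset.sum_congr rfl fun i _ => ?_
      rw [← hξ i, abs_of_pos (sub_pos.2 (hlt i)), mul_comm]
    rw [hγ] at hmap
    rw [← hmap]
    set E : Fin (d + 1) → Ω → ℝ := fun k ω =>
      ∑ i ∈ Finset.range N, ξ i ^ (k : ℕ) * (L (x (i + 1)) ω - L (x i) ω) - Z ω k
    have hdiff : ∀ ω, ∑ i ∈ Finset.range N, p.eval (ξ i) * (L (x (i + 1)) ω - L (x i) ω) -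
        ((fun w => pairing w p) ∘ Z) ω = ∑ k : Fin (d + 1), p.coeff k * E k ω := by
      intro ω
      simp only [E, Function.comp, pairing]
      simp_rw [fun k : Fin (d + 1) => mul_sub (p.coeff k)
        (∑ i ∈ Finset.range N, ξ i ^ (k : ℕ) * (L (x (i + 1)) ω - L (x i) ω)) (Z ω k)]
      rw [Finset.sum_sub_distrib]
      congr 1
      simp_rw [Finset.mul_sum]
      rw [Finset.sum_comm]
      refine Finset.sum_congr rfl fun i _ => ?_
      rw [Polynomial.eval_eq_sum_range' (Nat.lt_succ_of_le hp), Finset.sum_range, Finset.sum_mul]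
      exact Finset.sum_congr rfl fun k _ => by ring
    have hbad : P {ω | (∑ k : Fin (d + 1), |p.coeff k|) * η <
        |∑ i ∈ Finset.range N, p.eval (ξ i) * (L (x (i + 1)) ω - L (x i) ω) -
          ((fun w => pairing w p) ∘ Z) ω|} ≤ ENNReal.ofReal ((d + 1) * η) := by
      have hsub : {ω | (∑ k : Fin (d + 1), |p.coeff k|) * η <
          |∑ i ∈ Finset.range N, p.eval (ξ i) * (L (x (i + 1)) ω - L (x i) ω) -
          ((fun w => pairing w p) ∘ Z) ω|} ⊆ ⋃ k : Fin (d + 1), {ω | η ≤ |E k ω|} := by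
        intro ω hω
        by_contra hc
        simp only [mem_iUnion, mem_ofPred_eq, not_exists, not_le] at hc
        refine absurd (mem_ofPred_eq ▸ hω : _ < _) (not_lt.2 ?_)
        rw [hdiff, Finset.sum_mul]
        refine (Finset.abs_sum_le_sum_abs _ _).trans (Finset.sum_le_sum fun k _ => ?_)
        rw [abs_mul]
        exact mul_le_mul_of_nonneg_left (hc k).le (abs_nonneg _)
      refine (measure_mono hsub).trans ((measure_iUnion_fintype_le P _).trans ?_)
      have : ∀ k : Fin (d + 1), P {ω | η ≤ |E k ω|} ≤ ENNReal.ofReal η := fun k =>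
        hR k N x ξ hx0 hxN fun i _ => ⟨hξ1 i, hξ2 i, by
          rw [hstep]; simpa [N] using hM k⟩
      refine (Finset.sum_le_sum fun k _ => this k).trans_eq ?_
      rw [Finset.sum_const, Finset.card_univ, Fintype.card_fin, nsmul_eq_mul,
        ENNReal.ofReal_mul (by positivity)]
      congr 1
      rw [← Nat.cast_succ, ENNReal.ofReal_natCast]
    refine (norm_charFun_sub_le ?_ hVm t (by positivity) (by positivity) hbad).trans_eq ?_
    · exact (Finset.measurable_fun_sum _ fun i _ =>
        ((hL.measurable _).sub (hL.measurable _)).const_mul _).aemeasurable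
    · simp only [C]; ring
  have hzero : ‖charFun (cauchyMeasure 0 (unitNorm p)) t -
      charFun (P.map ((fun w => pairing w p) ∘ Z)) t‖ ≤ 0 := by
    refine le_of_forall_pos_le_add fun η hη => ?_
    refine (key (η / C) (by positivity)).trans_eq ?_
    field_simp
    simp
  exact (sub_eq_zero.1 (norm_le_zero_iff.1 hzero)).symm

/-! ### The geometric mean of independent Cauchy variables -/

/-- The geometric mean of `|y 0|, …, |y (t - 1)|`. -/
def geomMean (t : ℕ) (y : ℕ → ℝ) : ℝ := ∏ q ∈ Finset.range t, |y q| ^ (1 / (t : ℝ))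

lemma geomMean_zero {t : ℕ} (ht : 1 ≤ t) {y : ℕ → ℝ} (hy : ∀ q < t, y q = 0) :
    geomMean t y = 0 := by
  refine Finset.prod_eq_zero (Finset.mem_range.2 ht) ?_
  rw [hy 0 ht, abs_zero, Real.zero_rpow]
  have : (0 : ℝ) < t := by exact_mod_cast ht
  positivity

/-- Factoring out `γ` leaves the exponential of an average of logarithms. Nonzero values are needed
because `Real.log 0 = 0`. -/
lemma geomMean_eq_exp {t : ℕ} (ht : 1 ≤ t) {γ : ℝ} (hγ : 0 < γ) {y : ℕ → ℝ}
    (hy : ∀ q < t, y q ≠ 0) :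
    geomMean t y = γ * Real.exp ((∑ q ∈ Finset.range t, Real.log |γ⁻¹ * y q|) / t) := by
  have ht' : (t : ℝ) ≠ 0 := by positivity
  have h1 : ∀ q ∈ Finset.range t,
      |y q| ^ (1 / (t : ℝ)) = Real.exp ((Real.log γ + Real.log |γ⁻¹ * y q|) / t) := by
    intro q hq
    have hq' : 0 < |y q| := abs_pos.2 (hy q (Finset.mem_range.1 hq))
    rw [Real.rpow_def_of_pos hq', abs_mul, Real.log_mul (by positivity) hq'.ne',
      abs_of_pos (inv_pos.2 hγ), Real.log_inv]
    congr 1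
    ring
  rw [geomMean, Finset.prod_congr rfl h1, ← Real.exp_sum, ← Finset.sum_div,
    Finset.sum_add_distrib, Finset.sum_const, Finset.card_range, nsmul_eq_mul, add_div,
    mul_div_cancel_left₀ _ ht', Real.exp_add, Real.exp_log hγ]

lemma one_sub_mul_exp_le_one {ε v : ℝ} (hε : 0 < ε) (hv : v ≤ 2 / 3 * ε) :
    (1 - ε) * Real.exp v ≤ 1 := by
  have h1 : 1 - ε ≤ Real.exp (-ε) := by linarith [Real.add_one_le_exp (-ε)]
  calc (1 - ε) * Real.exp v ≤ Real.exp (-ε) * Real.exp v := by gcongr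
    _ = Real.exp (v - ε) := by rw [← Real.exp_add]; ring_nf
    _ ≤ 1 := Real.exp_le_one_iff.2 (by linarith)

/-- `log (1 + ε) ≥ 2ε / (2 + ε) ≥ 2ε/3` since `ε < 1`; this determines the tolerance `2ε/3` for the
average logarithm. -/
lemma one_le_one_add_mul_exp {ε v : ℝ} (hε : 0 < ε) (hε1 : ε < 1) (hv : -(2 / 3 * ε) ≤ v) :
    1 ≤ (1 + ε) * Real.exp v := by
  have h1 : 2 / 3 * ε ≤ Real.log (1 + ε) := by
    refine le_trans ?_ (Real.le_log_one_add_of_nonneg hε.le)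
    rw [le_div_iff₀ (by linarith)]
    nlinarith
  calc (1 : ℝ) ≤ Real.exp (Real.log (1 + ε) + v) := Real.one_le_exp_iff.2 (by linarith)
    _ = _ := by rw [Real.exp_add, Real.exp_log (by linarith)]

section Tail

variable {Ω : Type*} [MeasurableSpace Ω] {P : Measure Ω} [IsProbabilityMeasure P]

/-- Chernoff bound with parameter `±ε/8`. The exponent is `tε²` times `-1/12 + 2.8/64`, which is
below `-1/32`. -/
lemma measure_sum_log_abs_ge_le {W : ℕ → Ω → ℝ} (hW : iIndepFun W P) (hm : ∀ q, Measurable (W q))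
    (hl : ∀ q, P.map (W q) = cauchyMeasure 0 1) (t : ℕ) {ε : ℝ} (hε : 0 < ε) (hε1 : ε < 1) :
    P.real {ω | t * (2 / 3 * ε) ≤ ∑ q ∈ Finset.range t, Real.log |W q ω|} ≤
        Real.exp (-(t * ε ^ 2 / 32)) ∧
      P.real {ω | ∑ q ∈ Finset.range t, Real.log |W q ω| ≤ -(t * (2 / 3 * ε))} ≤
        Real.exp (-(t * ε ^ 2 / 32)) := by
  have hX : iIndepFun (fun q ω => Real.log |W q ω|) P :=
    hW.comp (fun _ x => Real.log |x|) fun _ => by fun_prop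
  have hXm : ∀ q, Measurable (fun ω => Real.log |W q ω|) := fun q => by
    have := hm q
    fun_prop
  have hfun : (∑ q ∈ Finset.range t, fun ω => Real.log |W q ω|) =
      fun ω => ∑ q ∈ Finset.range t, Real.log |W q ω| := by
    funext ω
    simp
  have hmgf1 : ∀ q, ∀ l : ℝ, |l| ≤ 1 / 2 →
      mgf (fun ω => Real.log |W q ω|) P l ≤ Real.exp (2.8 * l ^ 2) ∧
      Integrable (fun ω => Real.exp (l * Real.log |W q ω|)) P := by
    intro q l hl2
    have hg : Measurable fun x : ℝ => Real.exp (l * Real.log |x|) := by fun_prop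
    constructor
    · refine le_trans (le_of_eq ?_) (mgf_log_abs_cauchyMeasure_le hl2)
      rw [← hl q, mgf, mgf, integral_map (hm q).aemeasurable hg.aestronglyMeasurable]
    · have h := integrable_exp_mul_log_abs hl2
      rw [← hl q, integrable_map_measure hg.aestronglyMeasurable (hm q).aemeasurable] at h
      exact h
  have hmgf : ∀ l : ℝ, |l| ≤ 1 / 2 →
      mgf (fun ω => ∑ q ∈ Finset.range t, Real.log |W q ω|) P l ≤
        Real.exp (t * (2.8 * l ^ 2)) ∧
      Integrable (fun ω => Real.exp (l * ∑ q ∈ Finset.range t, Real.log |W q ω|)) P := by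
    intro l hl2
    constructor
    · rw [← hfun, hX.mgf_sum hXm]
      refine (Finset.prod_le_prod (fun q _ => mgf_nonneg) fun q _ => (hmgf1 q l hl2).1).trans_eq ?_
      rw [Finset.prod_const, Finset.card_range, ← Real.exp_nat_mul]
    · have h := hX.integrable_exp_mul_sum hXm (s := Finset.range t) fun q _ => (hmgf1 q l hl2).2
      simpa using h
  have hsq : (0 : ℝ) ≤ t * ε ^ 2 := by positivity
  have habs : |ε / 8| ≤ 1 / 2 := by rw [abs_of_pos (by positivity)]; linarith
  constructor
  · have h := hmgf (ε / 8) habs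
    refine (measure_ge_le_exp_mul_mgf _ (by positivity) h.2).trans ?_
    refine (mul_le_mul_of_nonneg_left h.1 (Real.exp_pos _).le).trans ?_
    rw [← Real.exp_add]
    exact Real.exp_le_exp.2 (by nlinarith)
  · have h := hmgf (-(ε / 8)) (by rwa [abs_neg])
    refine (measure_le_le_exp_mul_mgf _ (by linarith) h.2).trans ?_
    refine (mul_le_mul_of_nonneg_left h.1 (Real.exp_pos _).le).trans ?_
    rw [← Real.exp_add]
    exact Real.exp_le_exp.2 (by nlinarith)

theorem measure_geomMean_bad_le {Y : ℕ → Ω → ℝ} (hY : iIndepFun Y P)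
    (hm : ∀ q, Measurable (Y q)) {γ : NNReal} (hl : ∀ q, P.map (Y q) = cauchyMeasure 0 γ)
    {t : ℕ} (ht : 1 ≤ t) {ε : ℝ} (hε : 0 < ε) (hε1 : ε < 1) :
    P {ω | ¬ ((1 - ε) * geomMean t (fun q => Y q ω) ≤ γ ∧
        (γ : ℝ) ≤ (1 + ε) * geomMean t (fun q => Y q ω))} ≤
      ENNReal.ofReal (2 * Real.exp (-(t * ε ^ 2 / 32))) := by
  -- At scale zero all variables vanish almost surely, and so does the geometric mean, because `t ≥
  -- 1`.
  by_cases hγ : γ = 0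
  · have h0 : ∀ q, ∀ᵐ ω ∂P, Y q ω = 0 := by
      intro q
      have h : ∀ᵐ y ∂(P.map (Y q)), y = 0 := by
        rw [hl q, hγ, cauchyMeasure_zero_scale]
        exact (ae_dirac_iff (p := fun y : ℝ => y = 0) (measurableSet_singleton 0)).2 rfl
      exact ae_of_ae_map (hm q).aemeasurable h
    have h1 : ∀ᵐ ω ∂P, (1 - ε) * geomMean t (fun q => Y q ω) ≤ γ ∧
        (γ : ℝ) ≤ (1 + ε) * geomMean t (fun q => Y q ω) := by
      filter_upwards [ae_all_iff.2 h0] with ω hω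
      rw [geomMean_zero ht fun q _ => hω q, hγ]
      simp
    rw [ae_iff] at h1
    rw [h1]
    exact zero_le
  have hγ' : (0 : ℝ) < γ := by positivity
  set W : ℕ → Ω → ℝ := fun q ω => (γ : ℝ)⁻¹ * Y q ω
  have hW : iIndepFun W P := hY.comp (fun _ y => (γ : ℝ)⁻¹ * y) fun _ => by fun_prop
  have hWm : ∀ q, Measurable (W q) := fun q => (hm q).const_mul _
  have hWl : ∀ q, P.map (W q) = cauchyMeasure 0 1 := by
    intro q
    have h := Measure.map_map (μ := P) (measurable_const_mul (γ : ℝ)⁻¹) (hm q)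
    rw [hl q, map_const_mul_cauchyMeasure] at h
    rw [show W q = (fun x => (γ : ℝ)⁻¹ * x) ∘ Y q from rfl, ← h]
    congr 1
    ext
    simp [hγ]
  obtain ⟨h1, h2⟩ := measure_sum_log_abs_ge_le hW hWm hWl t hε hε1
  -- A nondegenerate Cauchy law has a density, so the value `0`, where the logarithm is meaningless,
  -- has probability zero.
  have hne : ∀ q, P {ω | Y q ω = 0} = 0 := by
    intro q
    have h : P.map (Y q) {0} = 0 := by
      rw [hl q, cauchyMeasure_of_scale_ne_zero 0 hγ]
      exact withDensity_absolutelyContinuous _ _ (by simp)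
    rwa [Measure.map_apply (hm q) (measurableSet_singleton 0)] at h
  have hsub : {ω | ¬ ((1 - ε) * geomMean t (fun q => Y q ω) ≤ γ ∧
      (γ : ℝ) ≤ (1 + ε) * geomMean t (fun q => Y q ω))} ⊆
      (⋃ q, {ω | Y q ω = 0}) ∪
      ({ω | t * (2 / 3 * ε) ≤ ∑ q ∈ Finset.range t, Real.log |W q ω|} ∪
        {ω | ∑ q ∈ Finset.range t, Real.log |W q ω| ≤ -(t * (2 / 3 * ε))}) := by
    intro ω hω
    by_contra hc
    simp only [mem_union, mem_iUnion, mem_ofPred_eq, not_or, not_exists, not_le] at hc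
    refine hω ?_
    have ht' : (0 : ℝ) < t := by exact_mod_cast ht
    rw [geomMean_eq_exp ht hγ' fun q _ => hc.1 q]
    set v := (∑ q ∈ Finset.range t, Real.log |(γ : ℝ)⁻¹ * Y q ω|) / t
    have hv1 : v ≤ 2 / 3 * ε := by
      rw [div_le_iff₀ ht', mul_comm]
      exact hc.2.1.le
    have hv2 : -(2 / 3 * ε) ≤ v := by
      rw [le_div_iff₀ ht', neg_mul, mul_comm]
      exact hc.2.2.le
    have e1 := mul_le_mul_of_nonneg_left (one_sub_mul_exp_le_one hε hv1) hγ'.le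
    have e2 := mul_le_mul_of_nonneg_left (one_le_one_add_mul_exp hε hε1 hv2) hγ'.le
    constructor <;> linarith
  refine (measure_mono hsub).trans ((measure_union_le _ _).trans ?_)
  rw [measure_iUnion_null hne, zero_add, two_mul, ENNReal.ofReal_add (Real.exp_pos _).le
    (Real.exp_pos _).le]
  refine (measure_union_le _ _).trans (add_le_add ?_ ?_)
  · rw [← ofReal_measureReal]
    exact ENNReal.ofReal_le_ofReal h1
  · rw [← ofReal_measureReal]
    exact ENNReal.ofReal_le_ofReal h2

end Tail

/-! ### Blocks of independent samples -/

/-- The projection of the `q`-th block of `N` samples along `p 0, …, p (N - 1)`. -/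
def blockSum {d : ℕ} (N : ℕ) (p : ℕ → Polynomial ℝ) (w : ℕ → Fin (d + 1) → ℝ) (q : ℕ) : ℝ :=
  ∑ i ∈ Finset.range N, pairing (w (q * N + i)) (p i)

section Blocks

variable {d : ℕ} (μ : Measure (Fin (d + 1) → ℝ)) [IsProbabilityMeasure μ] (N : ℕ)

lemma map_block_infinitePi (q : ℕ) :
    (Measure.infinitePi fun _ : ℕ => μ).map (fun w (i : Fin N) => w (q * N + i)) =
      Measure.infinitePi fun _ : Fin N => μ :=
  Measure.map_infinitePi_infinitePi_of_inj (P := fun _ : ℕ => μ) (f := fun i : Fin N => q * N + i)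
    fun i j h => Fin.ext (by simpa using h)

/-- Distinct pairs `(q, i)` address distinct samples, so the joint law of the blocks is the product
measure, reindexed and curried. -/
lemma iIndepFun_block :
    iIndepFun (fun (q : ℕ) (w : ℕ → Fin (d + 1) → ℝ) (i : Fin N) => w (q * N + i))
      (Measure.infinitePi fun _ : ℕ => μ) := by
  rw [iIndepFun_iff_map_fun_eq_infinitePi_map (by fun_prop)]
  simp_rw [map_block_infinitePi]
  have hinj : Function.Injective (fun qi : ℕ × Fin N => qi.1 * N + (qi.2 : ℕ)) := by
    rintro ⟨q, i⟩ ⟨q', i'⟩ h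
    have hN : 0 < N := i.pos
    simp only at h
    have h1 := congrArg (· / N) h
    have h2 := congrArg (· % N) h
    simp only [mul_comm _ N, Nat.mul_add_div hN, Nat.mul_add_mod, Nat.div_eq_of_lt i.2,
      Nat.div_eq_of_lt i'.2, Nat.mod_eq_of_lt i.2, Nat.mod_eq_of_lt i'.2, add_zero] at h1 h2
    rw [Prod.mk.injEq]
    exact ⟨h1, Fin.ext h2⟩
  rw [← Measure.infinitePi_map_curry (fun (_ : ℕ) (_ : Fin N) => μ),
    ← Measure.map_infinitePi_infinitePi_of_inj (P := fun _ : ℕ => μ) hinj,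
    Measure.map_map (by fun_prop) (by fun_prop)]
  rfl

lemma measurable_blockSum (p : ℕ → Polynomial ℝ) (q : ℕ) :
    Measurable (fun w : ℕ → Fin (d + 1) → ℝ => blockSum N p w q) := by
  unfold blockSum
  exact Finset.measurable_fun_sum _ fun i _ =>
    (measurable_pairing (p i)).comp (measurable_pi_apply _)

lemma iIndepFun_blockSum (p : ℕ → Polynomial ℝ) :
    iIndepFun (fun q (w : ℕ → Fin (d + 1) → ℝ) => blockSum N p w q)
      (Measure.infinitePi fun _ : ℕ => μ) := by
  have h := (iIndepFun_block μ N).comp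
    (fun (_ : ℕ) (v : Fin N → Fin (d + 1) → ℝ) => ∑ i : Fin N, pairing (v i) (p i)) fun q =>
      Finset.measurable_fun_sum _ fun i _ =>
        (measurable_pairing (p i)).comp (measurable_pi_apply _)
  convert! h using 3 with q
  simp [blockSum, Finset.sum_range]

variable {μ} in
lemma IsCI.map_blockSum (h : IsCI d 0 1 μ) {p : ℕ → Polynomial ℝ}
    (hp : ∀ i, (p i).natDegree ≤ d) (q : ℕ) :
    (Measure.infinitePi fun _ : ℕ => μ).map (fun w => blockSum N p w q) =
      cauchyMeasure 0 (∑ i ∈ Finset.range N, unitNorm (p i)) := by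
  simp only [blockSum, Finset.sum_range]
  have hm : ∀ i : Fin N, Measurable
      (fun w : ℕ → Fin (d + 1) → ℝ => pairing (w (q * N + i)) (p i)) :=
    fun i => (measurable_pairing (p i)).comp (measurable_pi_apply _)
  have hind : iIndepFun
      (fun (i : Fin N) (w : ℕ → Fin (d + 1) → ℝ) => pairing (w (q * N + i)) (p i))
      (Measure.infinitePi fun _ : ℕ => μ) := by
    have h1 : iIndepFun (fun (i : ℕ) (w : ℕ → Fin (d + 1) → ℝ) => w i)
        (Measure.infinitePi fun _ : ℕ => μ) :=
      iIndepFun_infinitePi (X := fun _ x => x) (by fun_prop)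
    have h2 := h1.precomp (g := fun i : Fin N => q * N + (i : ℕ))
      fun i j h => Fin.ext (by simpa using h)
    exact h2.comp (fun (i : Fin N) v => pairing v (p i)) fun i => measurable_pairing (p i)
  refine map_sum_eq_cauchyMeasure hind (fun i => (hm i).aemeasurable) fun i => ?_
  have h2 := Measure.map_map (μ := Measure.infinitePi fun _ : ℕ => μ) (measurable_pairing (p i))
    (measurable_pi_apply (q * N + (i : ℕ)))
  rw [Measure.infinitePi_map_eval, h.map_pairing (hp i)] at h2
  exact h2.symm

end Blocks

lemma IsCI.isProbabilityMeasure {d : ℕ} {a b : ℝ} {μ : Measure (Fin (d + 1) → ℝ)}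
    (h : IsCI d a b μ) : IsProbabilityMeasure μ := by
  obtain ⟨Ω, _, P, L, Z, hP, -, -, hlaw⟩ := h
  rw [← hlaw.map_eq]
  exact Measure.isProbabilityMeasure_map hlaw.aemeasurable

/-! ### Projections of a family of piecewise polynomials -/

section Pairing

variable {d : ℕ} (w : Fin (d + 1) → ℝ)

lemma pairing_add (p q : Polynomial ℝ) : pairing w (p + q) = pairing w p + pairing w q := by
  simp [pairing, add_mul, Finset.sum_add_distrib]

lemma pairing_sub (p q : Polynomial ℝ) : pairing w (p - q) = pairing w p - pairing w q := by
  simp [pairing, sub_mul, Finset.sum_sub_distrib]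

lemma pairing_zero : pairing w 0 = 0 := by simp [pairing]

lemma pairing_C_mul (c : ℝ) (p : Polynomial ℝ) :
    pairing w (Polynomial.C c * p) = c * pairing w p := by
  simp [pairing, Finset.mul_sum, mul_assoc]

lemma pairing_sum {ι : Type*} (s : Finset ι) (p : ι → Polynomial ℝ) :
    pairing w (∑ i ∈ s, p i) = ∑ i ∈ s, pairing w (p i) := by
  simp only [pairing, Polynomial.finsetSum_coeff, Finset.sum_mul]
  exact Finset.sum_comm

lemma pairing_X_pow {r : ℕ} (hr : r < d + 1) :
    pairing w (Polynomial.X ^ r) = w ⟨r, hr⟩ := by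
  rw [pairing, Finset.sum_eq_single ⟨r, hr⟩]
  · simp
  · intro k _ hk
    rw [Polynomial.coeff_X_pow, if_neg, zero_mul]
    exact fun h => hk (Fin.ext h)
  · simp

/-- Pairing of `w` with `x ^ r (u + h x) ^ k`. -/
def shiftRow (u h : ℝ) (k r : ℕ) : ℝ :=
  pairing w (Polynomial.X ^ r * (Polynomial.C u + Polynomial.C h * Polynomial.X) ^ k)

lemma shiftRow_zero (u h : ℝ) {r : ℕ} (hr : r < d + 1) : shiftRow w u h 0 r = w ⟨r, hr⟩ := by
  rw [shiftRow, pow_zero, mul_one, pairing_X_pow]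

/-- One factor `u + h x` is expanded. Starting from the sample itself, this recurrence reaches all
the powers `k ≤ d` in `O(d²)` operations; only entries with `r + k ≤ d` matter. -/
lemma shiftRow_succ (u h : ℝ) (k r : ℕ) :
    shiftRow w u h (k + 1) r = u * shiftRow w u h k r + h * shiftRow w u h k (r + 1) := by
  rw [shiftRow, shiftRow, shiftRow, ← pairing_C_mul, ← pairing_C_mul, ← pairing_add]
  congr 1
  ring

end Pairing

lemma sum_range_mul_eq (g : ℕ → ℝ) (N M : ℕ) :
    ∑ f ∈ Finset.range (N * M), g f =
      ∑ e ∈ Finset.range N, ∑ k ∈ Finset.range M, g (e * M + k) := by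
  induction N with
  | zero => simp
  | succ N ih => rw [Nat.succ_mul, Finset.sum_range_add, ih, Finset.sum_range_succ]

namespace PiecewiseFamily

variable {d m n s : ℕ} (F : PiecewiseFamily d m n s)

/-- The endpoints, as an array. -/
def node (i : ℕ) : ℝ := if h : i < s then F.a ⟨i, h⟩ else 0

/-- The left ends of the pieces, as an array. -/
def lo (e : ℕ) : ℕ :=
  if h : e / n < m ∧ e % n < n then (F.b ⟨e / n, h.1⟩ ⟨e % n, h.2⟩ : ℕ) else 0

/-- The right ends of the pieces, as an array. -/
def hi (e : ℕ) : ℕ :=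
  if h : e / n < m ∧ e % n < n then (F.c ⟨e / n, h.1⟩ ⟨e % n, h.2⟩ : ℕ) else 0

/-- The coefficients, as an array. -/
def coeff (i : ℕ) : ℝ :=
  if h : i / (d + 1) / n < m ∧ i / (d + 1) % n < n then
    F.α ⟨i / (d + 1) / n, h.1⟩ ⟨i / (d + 1) % n, h.2⟩
      ⟨i % (d + 1), Nat.mod_lt _ (Nat.succ_pos d)⟩
  else 0

lemma mul_add_div_mod {j l N : ℕ} (hl : l < N) : (j * N + l) / N = j ∧ (j * N + l) % N = l := by
  have hN : 0 < N := by omega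
  constructor
  · rw [mul_comm, Nat.mul_add_div hN, Nat.div_eq_of_lt hl, add_zero]
  · rw [mul_comm, Nat.mul_add_mod, Nat.mod_eq_of_lt hl]

lemma lo_eq (j : Fin m) (l : Fin n) : F.lo (j * n + l) = F.b j l := by
  obtain ⟨h1, h2⟩ := mul_add_div_mod (j := j) l.2
  simp only [lo, h1, h2, j.2, l.2, and_self, dite_true]

lemma hi_eq (j : Fin m) (l : Fin n) : F.hi (j * n + l) = F.c j l := by
  obtain ⟨h1, h2⟩ := mul_add_div_mod (j := j) l.2
  simp only [hi, h1, h2, j.2, l.2, and_self, dite_true]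

lemma coeff_eq (j : Fin m) (l : Fin n) (k : Fin (d + 1)) :
    F.coeff ((j * n + l) * (d + 1) + k) = F.α j l k := by
  obtain ⟨h1, h2⟩ := mul_add_div_mod (j := j) l.2
  obtain ⟨h3, h4⟩ := mul_add_div_mod (j := j * n + l) k.2
  simp only [coeff, h1, h2, h3, h4, j.2, l.2, and_self, dite_true]

lemma hi_lt_of_lt {e : ℕ} (he : e < m * n) : F.hi e < s := by
  have hn : 0 < n := Nat.pos_of_ne_zero fun h => by simp [h] at he
  have h1 : e / n < m := Nat.div_lt_of_lt_mul (by rwa [mul_comm])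
  simp only [hi, h1, Nat.mod_lt _ hn, and_self, dite_true, Fin.is_lt]

lemma lo_lt_of_lt {e : ℕ} (he : e < m * n) : F.lo e < s := by
  have hn : 0 < n := Nat.pos_of_ne_zero fun h => by simp [h] at he
  have h1 : e / n < m := Nat.div_lt_of_lt_mul (by rwa [mul_comm])
  simp only [lo, h1, Nat.mod_lt _ hn, and_self, dite_true, Fin.is_lt]

lemma node_mono {i j : ℕ} (hij : i ≤ j) (hj : j < s) : F.node i ≤ F.node j := by
  rw [node, node, dif_pos (hij.trans_lt hj), dif_pos hj]
  exact F.sorted hij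

lemma node_eq (i : Fin s) : F.node i = F.a i := by simp [node]

/-- Length of the `i`-th cell. -/
def mesh (i : ℕ) : ℝ := F.node (i + 1) - F.node i

/-- The affine map of `[0, 1]` onto the `i`-th cell. -/
def cellMap (i : ℕ) : Polynomial ℝ :=
  Polynomial.C (F.node i) + Polynomial.C (F.mesh i) * Polynomial.X

/-- The polynomial that equals `f_j` on the `i`-th cell. -/
def cellPoly (j : Fin m) (i : ℕ) : Polynomial ℝ :=
  ∑ l : Fin n, if (F.b j l : ℕ) ≤ i ∧ i < F.c j l then
    ∑ k : Fin (d + 1), Polynomial.C (F.α j l k) * Polynomial.X ^ (k : ℕ) else 0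

/-- The polynomial `f_j - f_k` on the `i`-th cell, transported to `[0, 1]`. -/
def cellDiff (j k : Fin m) (i : ℕ) : Polynomial ℝ :=
  Polynomial.C (F.mesh i) * (F.cellPoly j i - F.cellPoly k i).comp (F.cellMap i)

lemma natDegree_cellPoly_le (j : Fin m) (i : ℕ) : (F.cellPoly j i).natDegree ≤ d := by
  refine Polynomial.natDegree_sum_le_of_forall_le _ _ fun l _ => ?_
  split_ifs
  · refine Polynomial.natDegree_sum_le_of_forall_le _ _ fun k _ => ?_
    exact (Polynomial.natDegree_C_mul_X_pow_le _ _).trans (Nat.lt_succ_iff.1 k.2)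
  · simp

lemma natDegree_cellDiff_le (j k : Fin m) (i : ℕ) : (F.cellDiff j k i).natDegree ≤ d := by
  refine (Polynomial.natDegree_C_mul_le _ _).trans ?_
  refine Polynomial.natDegree_comp_le.trans ?_
  have h1 : (F.cellPoly j i - F.cellPoly k i).natDegree ≤ d :=
    (Polynomial.natDegree_sub_le _ _).trans
      (max_le (F.natDegree_cellPoly_le j i) (F.natDegree_cellPoly_le k i))
  have h2 : (F.cellMap i).natDegree ≤ 1 := by
    rw [cellMap, add_comm]
    exact Polynomial.natDegree_linear_le
  calc _ ≤ d * 1 := Nat.mul_le_mul h1 h2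
    _ = d := mul_one d

/-- No endpoint lies strictly inside a cell, so each piece contains the cell or misses it. A
repeated endpoint makes the half-open cell empty. -/
lemma fn_eq_eval_cellPoly (j : Fin m) {i : ℕ} (hi : i + 1 < s) {x : ℝ}
    (hx : x ∈ Ico (F.node i) (F.node (i + 1))) : F.fn j x = (F.cellPoly j i).eval x := by
  rw [fn, cellPoly, Polynomial.eval_finsetSum]
  refine Finset.sum_congr rfl fun l _ => ?_
  have hmem : x ∈ Ico (F.a (F.b j l)) (F.a (F.c j l)) ↔ (F.b j l : ℕ) ≤ i ∧ i < F.c j l := by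
    rw [← F.node_eq, ← F.node_eq]
    constructor
    · rintro ⟨h1, h2⟩
      constructor
      · by_contra hc
        exact absurd (hx.2.trans_le (F.node_mono (by omega) (F.b j l).2)) (not_lt.2 h1)
      · by_contra hc
        exact absurd ((F.node_mono (not_lt.1 hc) (by omega)).trans hx.1) (not_le.2 h2)
    · rintro ⟨h1, h2⟩
      exact ⟨(F.node_mono h1 (by omega)).trans hx.1, hx.2.trans_le (F.node_mono h2 (F.c j l).2)⟩
  by_cases h : (F.b j l : ℕ) ≤ i ∧ i < F.c j l
  · rw [indicator_of_mem (hmem.2 h), if_pos h, Polynomial.eval_finsetSum]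
    simp
  · rw [indicator_of_notMem (fun hc => h (hmem.1 hc)), if_neg h, Polynomial.eval_zero]

lemma fn_eq_zero (j : Fin m) {x : ℝ} (hx : x ∉ Ico (F.node 0) (F.node (s - 1))) :
    F.fn j x = 0 := by
  refine Finset.sum_eq_zero fun l _ => indicator_of_notMem (fun hc => hx ?_) _
  rw [← F.node_eq, ← F.node_eq] at hc
  have hs := (F.c j l).2
  exact ⟨(F.node_mono (Nat.zero_le _) (F.b j l).2).trans hc.1,
    hc.2.trans_le (F.node_mono (by omega) (by omega))⟩

/-- Change of variables; the factor `mesh i` in `cellDiff` is the Jacobian of `cellMap`. -/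
lemma coe_unitNorm_cellDiff (j k : Fin m) {i : ℕ} (hi : i + 1 < s) :
    (unitNorm (F.cellDiff j k i) : ℝ) =
      ∫ x in F.node i..F.node (i + 1), |F.fn j x - F.fn k x| := by
  have hle : F.node i ≤ F.node (i + 1) := F.node_mono (Nat.le_succ i) hi
  have hmesh : 0 ≤ F.mesh i := sub_nonneg.2 hle
  have h1 : ∫ x in F.node i..F.node (i + 1), |F.fn j x - F.fn k x| =
      ∫ x in F.node i..F.node (i + 1), |(F.cellPoly j i - F.cellPoly k i).eval x| := by
    rw [intervalIntegral.integral_of_le hle, intervalIntegral.integral_of_le hle,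
      ← integral_Ico_eq_integral_Ioc, ← integral_Ico_eq_integral_Ioc]
    refine setIntegral_congr_fun measurableSet_Ico fun x hx => ?_
    simp only [F.fn_eq_eval_cellPoly j hi hx, F.fn_eq_eval_cellPoly k hi hx, Polynomial.eval_sub]
  have h2 := intervalIntegral.mul_integral_comp_add_mul (a := 0) (b := 1)
    (f := fun x => |(F.cellPoly j i - F.cellPoly k i).eval x|) (F.mesh i) (F.node i)
  rw [mul_zero, add_zero, mul_one, show F.node i + F.mesh i = F.node (i + 1) by
    rw [mesh]; ring] at h2
  rw [unitNorm, Real.coe_toNNReal _ (intervalIntegral.integral_nonneg zero_le_one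
    fun _ _ => abs_nonneg _), h1, ← h2, ← intervalIntegral.integral_const_mul]
  congr 1
  funext x
  simp only [cellDiff, cellMap, Polynomial.eval_mul, Polynomial.eval_C, Polynomial.eval_comp,
    Polynomial.eval_add, Polynomial.eval_X, abs_mul, abs_of_nonneg hmesh]

theorem coe_sum_unitNorm_cellDiff (hF : F.IsDensityFamily) (j k : Fin m) :
    ((∑ i ∈ Finset.range (s - 1), unitNorm (F.cellDiff j k i) : NNReal) : ℝ) = F.dist j k := by
  push_cast
  have hint : Integrable (fun x => |F.fn j x - F.fn k x|) := ((hF j).2.1.sub (hF k).2.1).abs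
  rw [Finset.sum_congr rfl fun i hi =>
    F.coe_unitNorm_cellDiff j k (i := i) (by have := Finset.mem_range.1 hi; omega),
    intervalIntegral.sum_integral_adjacent_intervals fun i _ => hint.intervalIntegrable, dist]
  have hle : F.node 0 ≤ F.node (s - 1) := by
    rcases Nat.eq_zero_or_pos s with h | h
    · simp [h]
    · exact F.node_mono (Nat.zero_le _) (by omega)
  rw [intervalIntegral.integral_of_le hle, ← integral_Ico_eq_integral_Ioc]
  refine setIntegral_eq_integral_of_forall_compl_eq_zero fun x hx => ?_
  rw [F.fn_eq_zero j hx, F.fn_eq_zero k hx, sub_zero, abs_zero]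

lemma dist_nonneg (j k : Fin m) : 0 ≤ F.dist j k := integral_nonneg fun _ => abs_nonneg _

lemma dist_self (j : Fin m) : F.dist j j = 0 := by simp [dist]

/-- Justifies the constant output in the case `ε ≥ 1`. -/
lemma dist_le_two (hF : F.IsDensityFamily) (j k : Fin m) : F.dist j k ≤ 2 := by
  have h1 : F.dist j k ≤ ∫ x, (F.fn j x + F.fn k x) := by
    refine integral_mono ((hF j).2.1.sub (hF k).2.1).abs ((hF j).2.1.add (hF k).2.1) fun x => ?_
    have := (hF j).1 x
    have := (hF k).1 x
    exact abs_le.2 ⟨by linarith, by linarith⟩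
  rw [integral_add (hF j).2.1 (hF k).2.1, (hF j).2.2, (hF k).2.2] at h1
  linarith

/-- Every endpoint index is some `b j ℓ` or `c j ℓ`. This bounds the number of samples per
repetition. -/
lemma s_le (F : PiecewiseFamily d m n s) : s ≤ 2 * (m * n) := by
  have hsurj : Function.Surjective (fun x : Bool × Fin m × Fin n =>
      if x.1 then F.b x.2.1 x.2.2 else F.c x.2.1 x.2.2) := by
    intro i
    obtain ⟨j, l, h | h⟩ := F.endpoint i
    · exact ⟨(true, j, l), by simpa using h⟩
    · exact ⟨(false, j, l), by simpa using h⟩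
  simpa using Fintype.card_le_of_surjective _ hsurj

/-! ### The quantities computed by the algorithm -/

/-- `∫ x ^ k dL` over the `i`-th cell, computed from a sample. -/
def cellMoment (i k : ℕ) (v : Fin (d + 1) → ℝ) : ℝ :=
  F.mesh i * shiftRow v (F.node i) (F.mesh i) k 0

/-- `∫ x ^ k dL` over the first `i` cells. -/
def cumMoment (w : ℕ → Fin (d + 1) → ℝ) (i k : ℕ) : ℝ :=
  ∑ u ∈ Finset.range i, F.cellMoment u k (w u)

/-- Partial sums of the integrals of the monomials of all pieces. -/
def cumProj (w : ℕ → Fin (d + 1) → ℝ) (f : ℕ) : ℝ :=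
  ∑ g ∈ Finset.range f, F.coeff g * (F.cumMoment w (F.hi (g / (d + 1))) (g % (d + 1)) -
    F.cumMoment w (F.lo (g / (d + 1))) (g % (d + 1)))

/-- `∫ f_j dL`. -/
def sketch (w : ℕ → Fin (d + 1) → ℝ) (j : ℕ) : ℝ :=
  F.cumProj w ((j + 1) * (n * (d + 1))) - F.cumProj w (j * (n * (d + 1)))

lemma cumMoment_sub (w : ℕ → Fin (d + 1) → ℝ) {b c : ℕ} (hbc : b ≤ c) (hc : c < s) (k : ℕ) :
    F.cumMoment w c k - F.cumMoment w b k = ∑ i ∈ Finset.range (s - 1),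
      if b ≤ i ∧ i < c then F.cellMoment i k (w i) else 0 := by
  rw [cumMoment, cumMoment, ← Finset.sum_Ico_eq_sub _ hbc, ← Finset.sum_filter]
  refine Finset.sum_congr ?_ fun _ _ => rfl
  ext i
  simp only [Finset.mem_Ico, Finset.mem_filter, Finset.mem_range]
  omega

/-- The telescoped prefix sums are rearranged from a sum over pieces to a sum over cells, where each
cell uses its own sample. -/
lemma sketch_eq (w : ℕ → Fin (d + 1) → ℝ) (j : Fin m) :
    F.sketch w j = ∑ i ∈ Finset.range (s - 1),
      pairing (w i) (Polynomial.C (F.mesh i) * (F.cellPoly j i).comp (F.cellMap i)) := by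
  have h1 : F.sketch w j = ∑ l : Fin n, ∑ k : Fin (d + 1), F.α j l k *
      (F.cumMoment w (F.c j l) k - F.cumMoment w (F.b j l) k) := by
    rw [sketch, cumProj, cumProj, Nat.succ_mul, Finset.sum_range_add, add_sub_cancel_left,
      sum_range_mul_eq, Finset.sum_range]
    refine Finset.sum_congr rfl fun l _ => ?_
    rw [Finset.sum_range]
    refine Finset.sum_congr rfl fun k _ => ?_
    have h : (j : ℕ) * (n * (d + 1)) + (l * (d + 1) + k) = (j * n + l) * (d + 1) + k := by ring
    obtain ⟨h3, h4⟩ := mul_add_div_mod (j := j * n + l) k.2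
    rw [h, h3, h4, F.coeff_eq, F.lo_eq, F.hi_eq]
  rw [h1]
  simp_rw [F.cumMoment_sub w (F.b_lt_c _ _).le (F.c _ _).2, Finset.mul_sum]
  rw [Finset.sum_congr rfl fun l _ => Finset.sum_comm, Finset.sum_comm]
  refine Finset.sum_congr rfl fun i _ => ?_
  rw [cellPoly, Polynomial.sum_comp, pairing_C_mul, pairing_sum, Finset.mul_sum]
  refine Finset.sum_congr rfl fun l _ => ?_
  by_cases h : (F.b j l : ℕ) ≤ i ∧ i < F.c j l
  · simp only [h, and_self, if_true, Polynomial.sum_comp, pairing_sum, Finset.mul_sum]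
    refine Finset.sum_congr rfl fun k _ => ?_
    rw [Polynomial.mul_comp, Polynomial.C_comp, Polynomial.X_pow_comp, pairing_C_mul, cellMoment,
      shiftRow, pow_zero, one_mul, cellMap]
    ring
  · simp [h, pairing_zero]

/-- Linearity of the pairing, with both sketches taken from the same samples. This identifies what
the program computes with the variable whose law is known. -/
theorem sketch_sub_sketch (w : ℕ → Fin (d + 1) → ℝ) (q : ℕ) (j k : Fin m) :
    F.sketch (fun i => w (q * (s - 1) + i)) j - F.sketch (fun i => w (q * (s - 1) + i)) k =
      blockSum (s - 1) (F.cellDiff j k) w q := by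
  rw [sketch_eq, sketch_eq, ← Finset.sum_sub_distrib, blockSum]
  refine Finset.sum_congr rfl fun i _ => ?_
  rw [← pairing_sub, ← mul_sub, ← Polynomial.sub_comp, cellDiff]

end PiecewiseFamily

/-! ### Program logic with costs -/

/-- The program `p`, started in `σ`, halts after at most `c` operations in a state with `Q`. -/
def Reach {d : ℕ} (T : ℕ) (w : ℕ → Fin (d + 1) → ℝ) (p : Prog) (σ : State) (c : ℕ)
    (Q : State → Prop) : Prop :=
  ∃ σ' k, Exec T w p σ σ' k ∧ k ≤ c ∧ Q σ'

/-- The instruction writes only to registers `≥ x₀` and to the real arrays in `A`. -/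
def Instr.Within (x₀ : ℕ) (A : List ℕ) : Instr → Prop
  | .const x _ => x₀ ≤ x
  | .natOp _ x _ _ => x₀ ≤ x
  | .natLoad x _ _ => x₀ ≤ x
  | .natStore _ _ _ => False
  | .cast B _ _ => B ∈ A
  | .realOp _ B _ _ _ _ _ => B ∈ A
  | .root B _ _ _ _ => B ∈ A
  | .sample B _ => B ∈ A

/-- The program writes only to registers `≥ x₀` and to the real arrays in `A`. -/
def Prog.Within (x₀ : ℕ) (A : List ℕ) : Prog → Prop
  | .instr i => i.Within x₀ A
  | .seq p q => p.Within x₀ A ∧ q.Within x₀ A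
  | .ite _ p q => p.Within x₀ A ∧ q.Within x₀ A
  | .loop _ p => p.Within x₀ A

/-- `σ'` agrees with `σ` except in registers `≥ x₀` and in the real arrays in `A`. -/
structure Unchanged (x₀ : ℕ) (A : List ℕ) (σ σ' : State) : Prop where
  reg : ∀ x < x₀, σ'.reg x = σ.reg x
  nat : σ'.natArr = σ.natArr
  real : ∀ B, B ∉ A → σ'.realArr B = σ.realArr B

lemma Unchanged.refl (x₀ : ℕ) (A : List ℕ) (σ : State) : Unchanged x₀ A σ σ :=
  ⟨fun _ _ => rfl, rfl, fun _ _ => rfl⟩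

lemma Unchanged.trans {x₀ : ℕ} {A : List ℕ} {σ₁ σ₂ σ₃ : State} (h₁ : Unchanged x₀ A σ₁ σ₂)
    (h₂ : Unchanged x₀ A σ₂ σ₃) : Unchanged x₀ A σ₁ σ₃ :=
  ⟨fun x hx => (h₂.reg x hx).trans (h₁.reg x hx), h₂.nat.trans h₁.nat,
    fun B hB => (h₂.real B hB).trans (h₁.real B hB)⟩

lemma Unchanged.mono {x₀ x₁ : ℕ} {A A' : List ℕ} {σ σ' : State} (h : Unchanged x₀ A σ σ')
    (hx : x₁ ≤ x₀) (hA : A ⊆ A') : Unchanged x₁ A' σ σ' :=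
  ⟨fun x hx' => h.reg x (hx'.trans_le hx), h.nat, fun B hB => h.real B fun hc => hB (hA hc)⟩

lemma Instr.Within.unchanged {d : ℕ} {w : ℕ → Fin (d + 1) → ℝ} {x₀ : ℕ} {A : List ℕ} {i : Instr}
    (hi : i.Within x₀ A) (σ : State) : Unchanged x₀ A σ (i.run w σ) := by
  have hreg : ∀ x v, x₀ ≤ x → Unchanged x₀ A σ (σ.setReg x v) := fun x v hx =>
    ⟨fun y hy => Function.update_of_ne (by omega) _ _, rfl, fun _ _ => rfl⟩
  have hreal : ∀ B u v, B ∈ A → Unchanged x₀ A σ (σ.setReal B u v) := fun B u v hB =>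
    ⟨fun _ _ => rfl, rfl, fun C hC => Function.update_of_ne (by rintro rfl; exact hC hB) _ _⟩
  cases i with
  | const x v => exact hreg _ _ hi
  | natOp op x y z => exact hreg _ _ hi
  | natLoad x B y => exact hreg _ _ hi
  | natStore B x y => exact hi.elim
  | cast B x y => exact hreal _ _ _ hi
  | realOp op B x C y E z => exact hreal _ _ _ hi
  | root B x C y z => exact hreal _ _ _ hi
  | sample B x =>
    exact ⟨fun _ _ => rfl, rfl, fun C hC => Function.update_of_ne (by rintro rfl; exact hC hi) _ _⟩

/-- The frame rule. Nested loops use the counters 20, 30, 40, 50, and each body writes only to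
higher registers, so outer counters and bounds survive by a syntactic check. -/
lemma Exec.unchanged {d T : ℕ} {w : ℕ → Fin (d + 1) → ℝ} {x₀ : ℕ} {A : List ℕ} {p : Prog}
    {σ σ' : State} {k : ℕ} (h : Exec T w p σ σ' k) (hp : p.Within x₀ A) :
    Unchanged x₀ A σ σ' := by
  induction h with
  | instr i σ => exact Instr.Within.unchanged hp σ
  | seq _ _ ih₁ ih₂ => exact (ih₁ hp.1).trans (ih₂ hp.2)
  | ite_true _ _ ih => exact ih hp.1
  | ite_false _ _ ih => exact ih hp.2
  | loop_done _ => exact Unchanged.refl _ _ _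
  | loop_step _ _ _ ih₁ ih₂ => exact (ih₁ hp).trans (ih₂ hp)

/-- A straight-line program followed by `p`. -/
def Prog.after (l : List Instr) (p : Prog) : Prog := l.foldr (fun i q => .seq (.instr i) q) p

/-- `for x = 0, …, y - 1 do p`, where register `5` holds `1`. -/
def Prog.forLoop (x y : ℕ) (p : Prog) : Prog :=
  .seq (.instr (.const x 0)) (.loop (.natLt x y) (.seq p (.instr (.natOp .add x x 5))))

namespace Reach

variable {d T : ℕ} {w : ℕ → Fin (d + 1) → ℝ} {p q : Prog} {σ : State} {c c' : ℕ}
  {Q Q' : State → Prop}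

lemma mono (h : Reach T w p σ c Q) (hc : c ≤ c') (hQ : ∀ σ', Q σ' → Q' σ') :
    Reach T w p σ c' Q' := by
  obtain ⟨σ', k, h₁, h₂, h₃⟩ := h
  exact ⟨σ', k, h₁, h₂.trans hc, hQ _ h₃⟩

lemma instr {i : Instr} (h : Q (i.run w σ)) : Reach T w (.instr i) σ (i.cost T) Q :=
  ⟨_, _, .instr i σ, le_rfl, h⟩

lemma seq (h : Reach T w p σ c (fun σ' => Reach T w q σ' c' Q)) :
    Reach T w (.seq p q) σ (c + c') Q := by
  obtain ⟨σ₁, k₁, e₁, hk₁, σ₂, k₂, e₂, hk₂, hQ⟩ := h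
  exact ⟨σ₂, k₁ + k₂, .seq e₁ e₂, by omega, hQ⟩

lemma after {l : List Instr} (h : Reach T w p (l.foldl (Instr.run w) σ) c Q) :
    Reach T w (.after l p) σ ((l.map (Instr.cost T)).sum + c) Q := by
  induction l generalizing σ with
  | nil => simpa [Prog.after] using h
  | cons i l ih =>
    have := seq (T := T) (q := .after l p) (instr (T := T) (ih (σ := i.run w σ) h))
    rw [List.map_cons, List.sum_cons, add_assoc]
    exact this

lemma after_unchanged {l : List Instr} (x₀ : ℕ) (A : List ℕ) (hl : ∀ i ∈ l, i.Within x₀ A)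
    (h : ∀ τ, τ = l.foldl (Instr.run w) σ → Unchanged x₀ A σ τ → Reach T w p τ c Q) :
    Reach T w (.after l p) σ ((l.map (Instr.cost T)).sum + c) Q := by
  refine after (h _ rfl ?_)
  clear h
  induction l generalizing σ with
  | nil => exact Unchanged.refl _ _ _
  | cons i l ih =>
    rw [List.foldl_cons]
    exact ((hl i (by simp)).unchanged (w := w) σ).trans
      (ih fun j hj => hl j (List.mem_cons_of_mem _ hj))

lemma ite {e : Test} (h₁ : e.Holds σ → Reach T w p σ c Q) (h₂ : ¬ e.Holds σ → Reach T w q σ c Q) :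
    Reach T w (.ite e p q) σ (c + 1) Q := by
  by_cases he : e.Holds σ
  · obtain ⟨σ', k, e₁, hk, hQ⟩ := h₁ he
    exact ⟨σ', k + 1, .ite_true he e₁, by omega, hQ⟩
  · obtain ⟨σ', k, e₁, hk, hQ⟩ := h₂ he
    exact ⟨σ', k + 1, .ite_false he e₁, by omega, hQ⟩

/-- Rule for `for` loops. The invariant speaks about the real arrays and the number of draws; what
the loop leaves unchanged is known automatically. -/
lemma forLoop {x y : ℕ} {A : List ℕ} (Inv : ℕ → (ℕ → ℕ → ℝ) → ℕ → Prop) {N : ℕ}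
    (hN : σ.reg y = N) (hone : σ.reg 5 = 1) (hy : y < x) (h5 : 5 < x)
    (hp : p.Within (x + 1) A) (h₀ : Inv 0 σ.realArr σ.drawn)
    (step : ∀ i < N, ∀ σ' : State, σ'.reg x = i → Unchanged x A σ σ' →
      Inv i σ'.realArr σ'.drawn →
      Reach T w p σ' c (fun σ'' => Inv (i + 1) σ''.realArr σ''.drawn)) :
    Reach T w (.forLoop x y p) σ (N * (c + 2) + 2)
      (fun σ' => Inv N σ'.realArr σ'.drawn ∧ Unchanged x A σ σ') := by
  -- Induction on the number `r` of remaining iterations. Each costs the body plus a test and an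
  -- increment; the extra `1` is the final failing test.
  have main : ∀ r i : ℕ, i + r = N → ∀ σ' : State, σ'.reg x = i → Unchanged x A σ σ' →
      Inv i σ'.realArr σ'.drawn →
      Reach T w (.loop (.natLt x y) (.seq p (.instr (.natOp .add x x 5)))) σ' (r * (c + 2) + 1)
        (fun σ' => Inv N σ'.realArr σ'.drawn ∧ Unchanged x A σ σ') := by
    intro r
    induction r with
    | zero =>
      intro i hi σ' hx hu hI
      refine ⟨σ', 1, .loop_done ?_, by omega, ?_, hu⟩
      · rw [Test.Holds, hx, hu.reg y hy, hN]
        omega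
      · rwa [← show i = N by omega]
    | succ r ih =>
      intro i hi σ' hx hu hI
      obtain ⟨σ₁, k₁, e₁, hk₁, hI₁⟩ := step i (by omega) σ' hx hu hI
      have hu₁ := e₁.unchanged hp
      have hx₁ : σ₁.reg x = i := (hu₁.reg x (Nat.lt_succ_self x)).trans hx
      have hu₁' := hu.trans (hu₁.mono (Nat.le_succ x) (List.Subset.refl A))
      have h51 : σ₁.reg 5 = 1 := (hu₁'.reg 5 h5).trans hone
      have e₂ : Exec T w (.instr (.natOp .add x x 5)) σ₁ (σ₁.setReg x (i + 1)) 1 := by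
        have h := Exec.instr (T := T) (w := w) (.natOp .add x x 5) σ₁
        simpa only [Instr.run, NatOp.eval, Instr.cost, hx₁, h51] using h
      obtain ⟨σ₂, k₂, e₃, hk₂, hQ⟩ := ih (i + 1) (by omega) (σ₁.setReg x (i + 1))
        (by simp [State.setReg])
        (hu₁'.trans ⟨fun z hz => Function.update_of_ne (by omega) _ _, rfl, fun _ _ => rfl⟩) hI₁
      refine ⟨σ₂, (k₁ + 1) + k₂ + 1, .loop_step ?_ (.seq e₁ e₂) e₃, ?_, hQ⟩
      · rw [Test.Holds, hx, hu.reg y hy, hN]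
        omega
      · rw [Nat.succ_mul]
        omega
  have h := seq (T := T) (instr (T := T) (i := .const x 0) (main N 0 (by omega)
    (σ.setReg x 0) (by simp [State.setReg])
    ⟨fun z hz => Function.update_of_ne (by omega) _ _, rfl, fun _ _ => rfl⟩ h₀))
  exact h.mono (by simp only [Instr.cost]; omega) fun _ h => h

end Reach

/-! ### The program -/

/-- One round of the Taylor shift of a sample. -/
def shiftLoop : Prog :=
  .forLoop 50 0 (.after [.realOp .mul 8 13 0 30 4 50, .natOp .add 51 50 5,
    .realOp .mul 9 13 7 13 4 51] (.instr (.realOp .add 4 50 8 13 9 13)))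

/-- Appends the moments of one cell to the cumulative moments. -/
def momentLoop : Prog :=
  .forLoop 40 6 (.after [.natOp .mul 41 30 6, .natOp .add 41 41 40, .natOp .add 42 41 6,
    .realOp .mul 8 13 7 13 4 13, .realOp .add 5 42 5 41 8 13] shiftLoop)

/-- Draws the samples and computes the cumulative moments. -/
def cellLoop : Prog :=
  .forLoop 30 7 (.after [.natOp .add 31 30 5, .realOp .sub 7 13 0 31 0 30, .sample 4 13]
    momentLoop)

/-- Integrates the monomials of one piece. -/
def pieceLoop : Prog :=
  .forLoop 40 6 (.after [.natOp .add 41 32 40, .natOp .add 42 31 40, .realOp .sub 8 13 5 41 5 42,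
    .natOp .add 43 33 40, .realOp .mul 8 13 1 43 8 13, .natOp .add 44 43 5]
    (.instr (.realOp .add 6 44 6 43 8 13)))

/-- Integrates the monomials of all pieces. -/
def projLoop : Prog :=
  .forLoop 30 8 (.after [.natLoad 31 0 30, .natLoad 32 1 30, .natOp .mul 31 31 6,
    .natOp .mul 32 32 6, .natOp .mul 33 30 6] pieceLoop)

/-- Multiplies one row of the output by roots of differences of sketches. -/
def rowLoop : Prog :=
  .forLoop 40 1 (.after [.natOp .mul 41 40 9, .natOp .add 42 41 9, .realOp .sub 9 13 6 42 6 41,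
    .realOp .sub 9 13 8 13 9 13, .root 9 13 9 13 4, .natOp .add 43 33 40]
    (.instr (.realOp .mul 3 43 3 43 9 13)))

/-- Multiplies the output by roots of differences of sketches. -/
def pairLoop : Prog :=
  .forLoop 30 1 (.after [.natOp .mul 31 30 9, .natOp .add 32 31 9, .realOp .sub 8 13 6 32 6 31,
    .natOp .mul 33 30 1] rowLoop)

/-- One repetition of the experiment. -/
def roundLoop : Prog := .forLoop 20 11 (.seq cellLoop (.seq projLoop pairLoop))

/-- Fills the output with the content of register `12`. -/
def fillLoop : Prog := .forLoop 20 10 (.instr (.cast 3 20 12))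

/-- The whole algorithm. For `ε ≥ 1` it outputs `2` everywhere, otherwise geometric means. -/
def mainProg : Prog :=
  .after [.const 5 1, .natOp .add 6 0 5, .natOp .sub 7 3 5, .natOp .mul 8 1 2, .natOp .mul 9 2 6,
    .natOp .mul 10 1 1, .cast 8 13 5]
    (.seq (.ite (.realLt 2 13 8 13)
      (.after [.natOp .add 11 4 13] (.instr (.const 12 1)))
      (.after [.const 11 0] (.instr (.const 12 2))))
    (.seq fillLoop roundLoop))

/-! ### Correctness -/

section Correct

variable {d m n s : ℕ} (F : PiecewiseFamily d m n s) {T : ℕ} {w : ℕ → Fin (d + 1) → ℝ}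

/-- The values that are never modified after the initialization. -/
structure Ctx (t : ℕ) (σ : State) : Prop where
  r0 : σ.reg 0 = d
  r1 : σ.reg 1 = m
  r4 : σ.reg 4 = t
  r5 : σ.reg 5 = 1
  r6 : σ.reg 6 = d + 1
  r7 : σ.reg 7 = s - 1
  r8 : σ.reg 8 = m * n
  r9 : σ.reg 9 = n * (d + 1)
  r13 : σ.reg 13 = 0
  n0 : σ.natArr 0 = F.lo
  n1 : σ.natArr 1 = F.hi
  a0 : σ.realArr 0 = F.node
  a1 : σ.realArr 1 = F.coeff

variable {F}

/-- All constants live in registers below 14. Register 13 is never written, so it keeps its initial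
value and serves as the address zero. -/
lemma Ctx.unchanged {t : ℕ} {σ σ' : State} (h : Ctx F t σ) {x₀ : ℕ} {A : List ℕ}
    (hu : Unchanged x₀ A σ σ') (hx : 14 ≤ x₀) (h0 : 0 ∉ A) (h1 : 1 ∉ A) : Ctx F t σ' where
  r0 := (hu.reg _ (by omega)).trans h.r0
  r1 := (hu.reg _ (by omega)).trans h.r1
  r4 := (hu.reg _ (by omega)).trans h.r4
  r5 := (hu.reg _ (by omega)).trans h.r5
  r6 := (hu.reg _ (by omega)).trans h.r6
  r7 := (hu.reg _ (by omega)).trans h.r7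
  r8 := (hu.reg _ (by omega)).trans h.r8
  r9 := (hu.reg _ (by omega)).trans h.r9
  r13 := (hu.reg _ (by omega)).trans h.r13
  n0 := by rw [hu.nat, h.n0]
  n1 := by rw [hu.nat, h.n1]
  a0 := (hu.real _ h0).trans h.a0
  a1 := (hu.real _ h1).trans h.a1

/-- The row is overwritten in place from left to right: entry `r` needs only the old entries `r` and
`r + 1`. Entries with `r + k + 1 > d` become meaningless and are never used again. -/
lemma reach_shiftLoop {t : ℕ} {σ : State} (hσ : Ctx F t σ) (v : Fin (d + 1) → ℝ) (h : ℝ)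
    (h7 : σ.realArr 7 0 = h) (k : ℕ)
    (h4 : ∀ r, r + k ≤ d → σ.realArr 4 r = shiftRow v (F.node (σ.reg 30)) h k r) :
    Reach T w shiftLoop σ (d * 6 + 2) (fun σ' =>
      ((∀ r, r + (k + 1) ≤ d → σ'.realArr 4 r = shiftRow v (F.node (σ.reg 30)) h (k + 1) r) ∧
        σ'.drawn = σ.drawn) ∧ Unchanged 50 [4, 8, 9] σ σ') := by
  refine (Reach.forLoop (A := [4, 8, 9]) (c := 4) (N := d) (fun r R D =>
    (∀ u, (u < r → u + (k + 1) ≤ d → R 4 u = shiftRow v (F.node (σ.reg 30)) h (k + 1) u) ∧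
      (r ≤ u → u + k ≤ d → R 4 u = shiftRow v (F.node (σ.reg 30)) h k u)) ∧ D = σ.drawn)
    hσ.r0 hσ.r5 (by norm_num) (by norm_num) ?_ ?_ ?_).mono le_rfl ?_
  · simp [Prog.after, Prog.Within, Instr.Within]
  · exact ⟨fun u => ⟨fun hu => absurd hu (by omega), fun _ => h4 u⟩, rfl⟩
  · intro r hr σ' hx hu ⟨hI, hD⟩
    have hσ' := hσ.unchanged hu (by norm_num) (by simp) (by simp)
    have h7' : σ'.realArr 7 0 = h := by rw [hu.real 7 (by simp), h7]
    refine Reach.after (c := 1) (Reach.instr ?_)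
    simp only [List.foldl, Instr.run, State.setReal, State.setReg, NatOp.eval, RealOp.eval,
      Function.update_apply]
    norm_num
    simp only [hσ'.r13, hσ'.r5, hσ'.a0, hx, hu.reg 30 (by norm_num), h7', hD]
    refine ⟨fun u => ?_, trivial⟩
    simp only [Function.update_apply]
    split_ifs with hur
    · subst hur
      refine ⟨fun _ hud => ?_, fun hc => absurd hc (by omega)⟩
      rw [(hI u).2 le_rfl (by omega), (hI (u + 1)).2 (by omega) (by omega), shiftRow_succ]
    · exact ⟨fun h1 h2 => (hI u).1 (by omega) h2, fun h1 h2 => (hI u).2 (by omega) h2⟩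
  · rintro σ' ⟨⟨hI, hD⟩, hu⟩
    exact ⟨⟨fun r hr => (hI r).1 (by omega) hr, hD⟩, hu⟩

/-- The table of cumulative moments, row by row. -/
def momentTable (F : PiecewiseFamily d m n s) (w : ℕ → Fin (d + 1) → ℝ) (u : ℕ) : ℝ :=
  F.cumMoment w (u / (d + 1)) (u % (d + 1))

lemma momentTable_eq (x : ℕ → Fin (d + 1) → ℝ) {i k : ℕ} (hk : k < d + 1) :
    momentTable F x (i * (d + 1) + k) = F.cumMoment x i k := by
  obtain ⟨h1, h2⟩ := PiecewiseFamily.mul_add_div_mod (j := i) hk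
  rw [momentTable, h1, h2]

lemma momentTable_of_lt (x : ℕ → Fin (d + 1) → ℝ) {k : ℕ} (hk : k < d + 1) :
    momentTable F x k = 0 := by
  simpa [PiecewiseFamily.cumMoment] using momentTable_eq (F := F) x (i := 0) hk

lemma reach_momentLoop {t : ℕ} {σ : State} (hσ : Ctx F t σ) (x : ℕ → Fin (d + 1) → ℝ) {i : ℕ}
    (hi : σ.reg 30 = i) (h7 : σ.realArr 7 0 = F.mesh i)
    (h4 : ∀ r (hr : r < d + 1), σ.realArr 4 r = x i ⟨r, hr⟩)
    (h5 : ∀ u < (i + 1) * (d + 1), σ.realArr 5 u = momentTable F x u) :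
    Reach T w momentLoop σ ((d + 1) * (d * 6 + 9) + 2) (fun σ' =>
      ((∀ u < (i + 1 + 1) * (d + 1), σ'.realArr 5 u = momentTable F x u) ∧
        σ'.drawn = σ.drawn) ∧ Unchanged 40 [4, 5, 8, 9] σ σ') := by
  have hle : ∀ k, (i + 1) * (d + 1) + k = i * (d + 1) + k + (d + 1) := fun k => by ring
  refine (Reach.forLoop (A := [4, 5, 8, 9]) (c := d * 6 + 7) (N := d + 1) (fun k R D =>
    (∀ r, r + k ≤ d → R 4 r = shiftRow (x i) (F.node i) (F.mesh i) k r) ∧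
    (∀ u < (i + 1) * (d + 1) + k, R 5 u = momentTable F x u) ∧ D = σ.drawn)
    hσ.r6 hσ.r5 (by norm_num) (by norm_num) ?_ ?_ ?_).mono le_rfl ?_
  · simp [Prog.after, Prog.Within, Instr.Within, shiftLoop, Prog.forLoop]
  · refine ⟨fun r hr => ?_, fun u hu => h5 u hu, rfl⟩
    rw [h4 r (by omega), shiftRow_zero]
  · intro k hk σ' hx hu ⟨hI4, hI5, hD⟩
    have hσ' := hσ.unchanged hu (by norm_num) (by simp) (by simp)
    have h7' : σ'.realArr 7 0 = F.mesh i := by rw [hu.real 7 (by simp), h7]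
    have hi' : σ'.reg 30 = i := by rw [hu.reg 30 (by norm_num), hi]
    refine (Reach.after_unchanged (c := d * 6 + 2) 40 [5, 8] (by simp [Instr.Within])
      fun τ hτ hτu => ?_).mono (c := 5 + (d * 6 + 2)) (by omega) fun _ h => h
    simp only [List.foldl, Instr.run, State.setReal, State.setReg, NatOp.eval, RealOp.eval,
      Function.update_apply] at hτ
    norm_num at hτ
    simp only [hσ'.r13, hσ'.r6, hi', hx, h7'] at hτ
    have hτ4 : τ.realArr 4 = σ'.realArr 4 := hτu.real 4 (by simp)
    have hτ5 : τ.realArr 5 = Function.update (σ'.realArr 5) (i * (d + 1) + k + (d + 1))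
        (σ'.realArr 5 (i * (d + 1) + k) + F.mesh i * σ'.realArr 4 0) := by simp [hτ]
    have hcτ := hσ'.unchanged hτu (by norm_num) (by simp) (by simp)
    have h30 : τ.reg 30 = i := by rw [hτu.reg 30 (by norm_num), hi']
    refine (reach_shiftLoop hcτ (x i) (F.mesh i) (by rw [hτu.real 7 (by simp), h7']) k
      (by rw [hτ4, h30]; exact hI4)).mono le_rfl ?_
    rintro σ₁ ⟨⟨hs4, hsD⟩, hsu⟩
    rw [h30] at hs4
    refine ⟨hs4, fun u hu => ?_, ?_⟩
    · rw [hsu.real 5 (by simp), hτ5, Function.update_apply]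
      split_ifs with hc
      · rw [hI5 _ (by rw [hle]; omega), momentTable_eq x hk, hI4 0 (by omega), hc, ← hle,
          momentTable_eq x hk, PiecewiseFamily.cumMoment, PiecewiseFamily.cumMoment,
          Finset.sum_range_succ, PiecewiseFamily.cellMoment]
      · exact hI5 u (by rw [hle] at hu ⊢; omega)
    · rw [hsD, ← hD, hτ]
  · rintro σ' ⟨⟨-, hI5, hD⟩, hu⟩
    exact ⟨⟨fun u hu => hI5 u (by rw [Nat.succ_mul] at hu; omega), hD⟩, hu⟩

/-- Row `0` of the table has to vanish, since each later row is the previous one plus the moments of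
one cell. -/
lemma reach_cellLoop {t : ℕ} {σ : State} (hσ : Ctx F t σ) {N : ℕ} (hN : σ.drawn = N)
    (h5 : ∀ u < d + 1, σ.realArr 5 u = 0) :
    Reach T w cellLoop σ ((s - 1) * (T + (d + 1) * (d * 6 + 9) + 6) + 2) (fun σ' =>
      ((∀ u < (s - 1 + 1) * (d + 1), σ'.realArr 5 u = momentTable F (fun i => w (N + i)) u) ∧
        σ'.drawn = N + (s - 1)) ∧ Unchanged 30 [4, 5, 7, 8, 9] σ σ') := by
  refine (Reach.forLoop (A := [4, 5, 7, 8, 9]) (c := T + (d + 1) * (d * 6 + 9) + 4) (N := s - 1)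
    (fun i R D => (∀ u < (i + 1) * (d + 1), R 5 u = momentTable F (fun i => w (N + i)) u) ∧
      D = N + i)
    hσ.r7 hσ.r5 (by norm_num) (by norm_num) ?_ ?_ ?_).mono le_rfl fun _ h => h
  · simp [Prog.after, Prog.Within, Instr.Within, shiftLoop, momentLoop, Prog.forLoop]
  · refine ⟨fun u hu => ?_, hN⟩
    rw [zero_add, one_mul] at hu
    rw [h5 u hu, momentTable_of_lt _ hu]
  · intro i hi σ' hx hu ⟨hI, hD⟩
    have hσ' := hσ.unchanged hu (by norm_num) (by simp) (by simp)
    refine (Reach.after_unchanged (c := (d + 1) * (d * 6 + 9) + 2) 31 [4, 7]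
      (by simp [Instr.Within]) fun τ hτ hτu => ?_).mono
      (by simp only [List.map, Instr.cost, List.sum_cons, List.sum_nil]; omega) fun _ h => h
    simp only [List.foldl, Instr.run, State.setReal, State.setReg, State.putSample, NatOp.eval,
      RealOp.eval, Function.update_apply] at hτ
    norm_num at hτ
    simp only [hσ'.r13, hσ'.r5, hσ'.a0, hx, hD] at hτ
    have hcτ := hσ'.unchanged hτu (by norm_num) (by simp) (by simp)
    refine (reach_momentLoop hcτ (fun i => w (N + i)) (i := i)
      (by rw [hτu.reg 30 (by norm_num), hx]) (by simp [hτ, PiecewiseFamily.mesh]) ?_ ?_).mono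
      le_rfl ?_
    · intro r hr
      simp [hτ, Nat.lt_succ_iff.1 hr]
    · intro u hu
      rw [hτu.real 5 (by simp), hI u hu]
    · rintro σ₁ ⟨⟨h51, hD1⟩, -⟩
      refine ⟨h51, ?_⟩
      rw [hD1]
      simp [hτ, add_assoc]

/-- The integral of a monomial over a piece is a difference of two table entries, so the cost does
not depend on the number of cells in the piece. -/
lemma reach_pieceLoop {t : ℕ} {σ : State} (hσ : Ctx F t σ) (x : ℕ → Fin (d + 1) → ℝ) {e : ℕ}
    (he : e < m * n)
    (h31 : σ.reg 31 = F.lo e * (d + 1)) (h32 : σ.reg 32 = F.hi e * (d + 1))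
    (h33 : σ.reg 33 = e * (d + 1))
    (h5 : ∀ u < (s - 1 + 1) * (d + 1), σ.realArr 5 u = momentTable F x u)
    (h6 : ∀ f ≤ e * (d + 1), σ.realArr 6 f = F.cumProj x f) :
    Reach T w pieceLoop σ ((d + 1) * 9 + 2) (fun σ' =>
      ((∀ f ≤ (e + 1) * (d + 1), σ'.realArr 6 f = F.cumProj x f) ∧ σ'.drawn = σ.drawn) ∧
        Unchanged 40 [6, 8] σ σ') := by
  have hs1 : s - 1 + 1 = s := by have := F.hi_lt_of_lt he; omega
  have hlt : ∀ {i k}, i < s → k < d + 1 → i * (d + 1) + k < (s - 1 + 1) * (d + 1) := by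
    intro i k hi hk
    rw [hs1]
    nlinarith
  refine (Reach.forLoop (A := [6, 8]) (c := 7) (N := d + 1) (fun k R D =>
    (∀ f ≤ e * (d + 1) + k, R 6 f = F.cumProj x f) ∧ D = σ.drawn)
    hσ.r6 hσ.r5 (by norm_num) (by norm_num) ?_ ?_ ?_).mono le_rfl ?_
  · simp [Prog.after, Prog.Within, Instr.Within]
  · exact ⟨h6, rfl⟩
  · intro k hk σ' hx hu ⟨hI, hD⟩
    have hσ' := hσ.unchanged hu (by norm_num) (by simp) (by simp)
    refine Reach.after (c := 1) (Reach.instr ?_)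
    simp only [List.foldl, Instr.run, State.setReal, State.setReg, NatOp.eval, RealOp.eval,
      Function.update_apply]
    norm_num
    simp only [hσ'.r5, hσ'.a1, hx, hu.reg 31 (by norm_num), hu.reg 32 (by norm_num),
      hu.reg 33 (by norm_num), h31, h32, h33, hD, hu.real 5 (by simp)]
    refine ⟨fun f hf => ?_, trivial⟩
    simp only [Function.update_apply]
    split_ifs with hc
    · subst hc
      obtain ⟨e1, e2⟩ := PiecewiseFamily.mul_add_div_mod (j := e) hk
      rw [hI _ le_rfl, h5 _ (hlt (F.hi_lt_of_lt he) hk), h5 _ (hlt (F.lo_lt_of_lt he) hk),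
        momentTable_eq x hk, momentTable_eq x hk, PiecewiseFamily.cumProj,
        PiecewiseFamily.cumProj, Finset.sum_range_succ, e1, e2]
    · exact hI f (by omega)
  · rintro σ' ⟨⟨hI, hD⟩, hu⟩
    exact ⟨⟨fun f hf => hI f (by rwa [Nat.succ_mul] at hf), hD⟩, hu⟩

lemma reach_projLoop {t : ℕ} {σ : State} (hσ : Ctx F t σ) (x : ℕ → Fin (d + 1) → ℝ)
    (h5 : ∀ u < (s - 1 + 1) * (d + 1), σ.realArr 5 u = momentTable F x u)
    (h6 : σ.realArr 6 0 = 0) :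
    Reach T w projLoop σ (m * n * ((d + 1) * 9 + 9) + 2) (fun σ' =>
      ((∀ f ≤ m * n * (d + 1), σ'.realArr 6 f = F.cumProj x f) ∧ σ'.drawn = σ.drawn) ∧
        Unchanged 30 [6, 8] σ σ') := by
  refine (Reach.forLoop (A := [6, 8]) (c := (d + 1) * 9 + 7) (N := m * n) (fun e R D =>
    (∀ f ≤ e * (d + 1), R 6 f = F.cumProj x f) ∧ D = σ.drawn)
    hσ.r8 hσ.r5 (by norm_num) (by norm_num) ?_ ?_ ?_).mono le_rfl fun _ h => h
  · simp [Prog.after, Prog.Within, Instr.Within, pieceLoop, Prog.forLoop]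
  · refine ⟨fun f hf => ?_, rfl⟩
    rw [zero_mul, Nat.le_zero] at hf
    rw [hf, h6, PiecewiseFamily.cumProj, Finset.sum_range_zero]
  · intro e he σ' hx hu ⟨hI, hD⟩
    have hσ' := hσ.unchanged hu (by norm_num) (by simp) (by simp)
    refine (Reach.after_unchanged (c := (d + 1) * 9 + 2) 31 []
      (by simp [Instr.Within]) fun τ hτ hτu => ?_).mono
      (by simp only [List.map, Instr.cost, List.sum_cons, List.sum_nil]; omega) fun _ h => h
    simp only [List.foldl, Instr.run, State.setReg, NatOp.eval, Function.update_apply] at hτ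
    norm_num at hτ
    simp only [hσ'.r6, hσ'.n0, hσ'.n1, hx] at hτ
    have hcτ := hσ'.unchanged hτu (by norm_num) (by simp) (by simp)
    refine (reach_pieceLoop hcτ x he (by simp [hτ]) (by simp [hτ]) (by simp [hτ]) ?_ ?_).mono
      le_rfl ?_
    · rw [hτu.real 5 (by simp), hu.real 5 (by simp)]
      exact h5
    · rw [hτu.real 6 (by simp)]
      exact hI
    · rintro σ₁ ⟨⟨h61, hD1⟩, -⟩
      refine ⟨h61, ?_⟩
      rw [hD1, ← hD]
      simp [hτ]

/-- The factor that one repetition contributes to the cell `v` of the output. -/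
def pairFactor (F : PiecewiseFamily d m n s) (t : ℕ) (x : ℕ → Fin (d + 1) → ℝ) (v : ℕ) : ℝ :=
  |F.sketch x (v / m) - F.sketch x (v % m)| ^ (1 / (t : ℝ))

/-- The output is updated in row-major order, so the cells already multiplied are exactly those with
address below `j * m + k`. -/
lemma reach_rowLoop {t : ℕ} {σ : State} (hσ : Ctx F t σ) (x : ℕ → Fin (d + 1) → ℝ) {j : ℕ}
    (h8 : σ.realArr 8 0 = F.sketch x j) (h33 : σ.reg 33 = j * m)
    (h6 : ∀ f ≤ m * n * (d + 1), σ.realArr 6 f = F.cumProj x f) (base : ℕ → ℝ)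
    (h3 : ∀ v < m * m, σ.realArr 3 v = base v * if v < j * m then pairFactor F t x v else 1) :
    Reach T w rowLoop σ (m * 9 + 2) (fun σ' =>
      ((∀ v < m * m, σ'.realArr 3 v =
          base v * if v < (j + 1) * m then pairFactor F t x v else 1) ∧ σ'.drawn = σ.drawn) ∧
        Unchanged 40 [3, 9] σ σ') := by
  refine (Reach.forLoop (A := [3, 9]) (c := 7) (N := m) (fun k R D =>
    (∀ v < m * m, R 3 v = base v * if v < j * m + k then pairFactor F t x v else 1) ∧
      D = σ.drawn)
    hσ.r1 hσ.r5 (by norm_num) (by norm_num) ?_ ?_ ?_).mono le_rfl ?_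
  · simp [Prog.after, Prog.Within, Instr.Within]
  · exact ⟨h3, rfl⟩
  · intro k hk σ' hx hu ⟨hI, hD⟩
    have hσ' := hσ.unchanged hu (by norm_num) (by simp) (by simp)
    refine Reach.after (c := 1) (Reach.instr ?_)
    simp only [List.foldl, Instr.run, State.setReal, State.setReg, NatOp.eval, RealOp.eval,
      Function.update_apply]
    norm_num
    simp only [hσ'.r13, hσ'.r4, hσ'.r9, hx, hu.reg 33 (by norm_num), h33, hD,
      hu.real 6 (by simp), hu.real 8 (by simp), h8]
    refine ⟨fun v hv => ?_, trivial⟩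
    have hle : k * (n * (d + 1)) + n * (d + 1) ≤ m * n * (d + 1) := by
      rw [← Nat.succ_mul, mul_assoc]
      exact Nat.mul_le_mul_right _ hk
    obtain ⟨e1, e2⟩ := PiecewiseFamily.mul_add_div_mod (j := j) hk
    simp only [Function.update_apply]
    split_ifs with hc h2 h2
    · rw [hc, hI _ (hc ▸ hv), if_neg (lt_irrefl _), mul_one, pairFactor, e1, e2,
        h6 _ hle, h6 _ (by omega), one_div]
      congr 4
      rw [PiecewiseFamily.sketch, Nat.succ_mul]
    · omega
    · rw [hI v hv, if_pos (by omega)]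
    · rw [hI v hv, if_neg (by omega), mul_one]
  · rintro σ' ⟨⟨hI, hD⟩, hu⟩
    exact ⟨⟨fun v hv => by rw [hI v hv, Nat.succ_mul], hD⟩, hu⟩

lemma reach_pairLoop {t : ℕ} {σ : State} (hσ : Ctx F t σ) (x : ℕ → Fin (d + 1) → ℝ)
    (h6 : ∀ f ≤ m * n * (d + 1), σ.realArr 6 f = F.cumProj x f) :
    Reach T w pairLoop σ (m * (m * 9 + 8) + 2) (fun σ' =>
      ((∀ v < m * m, σ'.realArr 3 v = σ.realArr 3 v * pairFactor F t x v) ∧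
        σ'.drawn = σ.drawn) ∧ Unchanged 30 [3, 8, 9] σ σ') := by
  refine (Reach.forLoop (A := [3, 8, 9]) (c := m * 9 + 6) (N := m) (fun j R D =>
    (∀ v < m * m, R 3 v = σ.realArr 3 v * if v < j * m then pairFactor F t x v else 1) ∧
      D = σ.drawn)
    hσ.r1 hσ.r5 (by norm_num) (by norm_num) ?_ ?_ ?_).mono le_rfl ?_
  · simp [Prog.after, Prog.Within, Instr.Within, rowLoop, Prog.forLoop]
  · exact ⟨fun v hv => by simp, rfl⟩
  · intro j hj σ' hx hu ⟨hI, hD⟩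
    have hσ' := hσ.unchanged hu (by norm_num) (by simp) (by simp)
    refine (Reach.after_unchanged (c := m * 9 + 2) 31 [8]
      (by simp [Instr.Within]) fun τ hτ hτu => ?_).mono
      (by simp only [List.map, Instr.cost, List.sum_cons, List.sum_nil]; omega) fun _ h => h
    simp only [List.foldl, Instr.run, State.setReal, State.setReg, NatOp.eval,
      RealOp.eval, Function.update_apply] at hτ
    norm_num at hτ
    simp only [hσ'.r13, hσ'.r9, hσ'.r1, hx, hu.real 6 (by simp)] at hτ
    have hcτ := hσ'.unchanged hτu (by norm_num) (by simp) (by simp)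
    have hle : j * (n * (d + 1)) + n * (d + 1) ≤ m * n * (d + 1) := by
      rw [← Nat.succ_mul, mul_assoc]
      exact Nat.mul_le_mul_right _ hj
    refine (reach_rowLoop hcτ x (j := j) ?_ (by simp [hτ]) ?_ (σ.realArr 3) ?_).mono le_rfl ?_
    · simp only [hτ, Function.update_self]
      rw [h6 _ hle, h6 _ (by omega), PiecewiseFamily.sketch, Nat.succ_mul]
    · rw [hτu.real 6 (by simp), hu.real 6 (by simp)]
      exact h6
    · rw [hτu.real 3 (by simp)]
      exact hI
    · rintro σ₁ ⟨⟨h31, hD1⟩, -⟩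
      refine ⟨h31, ?_⟩
      rw [hD1, ← hD]
      simp [hτ]
  · rintro σ' ⟨⟨hI, hD⟩, hu⟩
    exact ⟨⟨fun v hv => by rw [hI v hv, if_pos hv], hD⟩, hu⟩

/-- Upper bound for the number of operations of one repetition. -/
def roundCost (d m n s T : ℕ) : ℕ :=
  (s - 1) * (T + (d + 1) * (d * 6 + 9) + 6) + 2 +
    ((m * n * ((d + 1) * 9 + 9) + 2) + (m * (m * 9 + 8) + 2))

lemma reach_roundLoop {t N : ℕ} {σ : State} (hσ : Ctx F t σ) (h11 : σ.reg 11 = N)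
    (h5 : σ.realArr 5 = 0) (h6 : σ.realArr 6 = 0) (hdr : σ.drawn = 0) :
    Reach T w roundLoop σ (N * (roundCost d m n s T + 2) + 2) (fun σ' =>
      ∀ v < m * m, σ'.realArr 3 v = σ.realArr 3 v *
        ∏ q ∈ Finset.range N, pairFactor F t (fun i => w (q * (s - 1) + i)) v) := by
  -- Besides the products, the invariant records that the zero row of array 5 and the zero cell of
  -- array 6 survive, and that round `q` begins after `q * (s - 1)` draws, hence reads the `q`-th
  -- block.
  refine (Reach.forLoop (A := [3, 4, 5, 6, 7, 8, 9]) (c := roundCost d m n s T) (N := N)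
    (fun q R D => (∀ v < m * m, R 3 v = σ.realArr 3 v *
        ∏ q ∈ Finset.range q, pairFactor F t (fun i => w (q * (s - 1) + i)) v) ∧
      (∀ u < d + 1, R 5 u = 0) ∧ R 6 0 = 0 ∧ D = q * (s - 1))
    h11 hσ.r5 (by norm_num) (by norm_num) ?_ ?_ ?_).mono le_rfl fun σ' h => h.1.1
  · simp [Prog.after, Prog.Within, Instr.Within, shiftLoop, momentLoop, cellLoop, pieceLoop,
      projLoop, rowLoop, pairLoop, Prog.forLoop]
  · simp [h5, h6, hdr]
  · intro q hq σ' hx hu ⟨hI3, hI5, hI6, hD⟩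
    have hσ' := hσ.unchanged hu (by norm_num) (by simp) (by simp)
    rw [roundCost]
    refine Reach.seq ((reach_cellLoop hσ' hD hI5).mono le_rfl ?_)
    rintro σ₁ ⟨⟨h51, hD1⟩, hu1⟩
    have hσ₁ := hσ'.unchanged hu1 (by norm_num) (by simp) (by simp)
    refine Reach.seq ((reach_projLoop hσ₁ _ h51 (by rw [hu1.real 6 (by simp), hI6])).mono
      le_rfl ?_)
    rintro σ₂ ⟨⟨h62, hD2⟩, hu2⟩
    have hσ₂ := hσ₁.unchanged hu2 (by norm_num) (by simp) (by simp)
    refine (reach_pairLoop hσ₂ _ h62).mono le_rfl ?_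
    rintro σ₃ ⟨⟨h33, hD3⟩, hu3⟩
    refine ⟨fun v hv => ?_, fun u hlt => ?_, ?_, ?_⟩
    · rw [h33 v hv, hu2.real 3 (by simp), hu1.real 3 (by simp), hI3 v hv, Finset.prod_range_succ,
        mul_assoc]
    · rw [hu3.real 5 (by simp), hu2.real 5 (by simp), h51 u (by nlinarith),
        momentTable_of_lt _ hlt]
    · rw [hu3.real 6 (by simp), h62 0 (Nat.zero_le _), PiecewiseFamily.cumProj,
        Finset.sum_range_zero]
    · rw [hD3, hD2, hD1, Nat.succ_mul]

lemma reach_fillLoop {t v : ℕ} {σ : State} (hσ : Ctx F t σ) (h10 : σ.reg 10 = m * m)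
    (h12 : σ.reg 12 = v) :
    Reach T w fillLoop σ (m * m * 3 + 2) (fun σ' =>
      ((∀ u < m * m, σ'.realArr 3 u = v) ∧ σ'.drawn = σ.drawn) ∧ Unchanged 20 [3] σ σ') := by
  refine Reach.forLoop (A := [3]) (c := 1) (N := m * m) (fun i R D =>
    (∀ u < i, R 3 u = v) ∧ D = σ.drawn)
    h10 hσ.r5 (by norm_num) (by norm_num) ?_ ?_ ?_
  · simp [Prog.Within, Instr.Within]
  · simp
  · intro i hi σ' hx hu ⟨hI, hD⟩
    refine Reach.instr ?_
    simp only [Instr.run, State.setReal, hx, hu.reg 12 (by norm_num), h12, Function.update_self]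
    refine ⟨fun u hlt => ?_, hD⟩
    rw [Function.update_apply]
    split_ifs with hc
    · rfl
    · exact hI u (by omega)

/-- Upper bound for the number of operations of the program. -/
def totalCost (d m n s t T : ℕ) : ℕ :=
  7 + (3 + ((m * m * 3 + 2) + (t * (roundCost d m n s T + 2) + 2)))

lemma initialized (F : PiecewiseFamily d m n s) (t : ℕ) (ε δ : ℝ) :
    ∀ σ, σ = [Instr.const 5 1, .natOp .add 6 0 5, .natOp .sub 7 3 5, .natOp .mul 8 1 2,
      .natOp .mul 9 2 6, .natOp .mul 10 1 1, .cast 8 13 5].foldl (Instr.run w)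
        (F.initState t ε δ) →
    Ctx F t σ ∧ σ.reg 10 = m * m ∧ σ.realArr 5 = 0 ∧ σ.realArr 6 = 0 ∧ σ.drawn = 0 ∧
      σ.realArr 2 0 = ε ∧ σ.realArr 8 0 = 1 := by
  rintro σ rfl
  simp only [List.foldl, Instr.run, State.setReg, State.setReal, NatOp.eval]
  refine ⟨⟨?_, ?_, ?_, ?_, ?_, ?_, ?_, ?_, ?_, rfl, rfl, ?_, ?_⟩, ?_, ?_, ?_, ?_, ?_, ?_⟩ <;>
  simp [PiecewiseFamily.initState]
  all_goals rfl

theorem reach_mainProg (F : PiecewiseFamily d m n s) {t : ℕ} (ε δ : ℝ) :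
    Reach T w mainProg (F.initState t ε δ) (totalCost d m n s t T) (fun σ =>
      (1 ≤ ε → ∀ v < m * m, σ.realArr 3 v = 2) ∧
      (ε < 1 → ∀ v < m * m, σ.realArr 3 v =
        ∏ q ∈ Finset.range t, pairFactor F t (fun i => w (q * (s - 1) + i)) v)) := by
  refine Reach.after_unchanged (c := 3 + ((m * m * 3 + 2) + (t * (roundCost d m n s T + 2) + 2)))
    0 [8] (by simp [Instr.Within]) fun τ hτ _ => ?_
  obtain ⟨hσ, h10, h5, h6, hD, h2, h8⟩ := initialized F t ε δ (w := w) τ hτ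
  refine Reach.seq (c := 3) (Reach.mono (c := 3) (Q := fun σ => Ctx F t σ ∧ σ.reg 10 = m * m ∧
    σ.realArr 5 = 0 ∧ σ.realArr 6 = 0 ∧ σ.drawn = 0 ∧
    (1 ≤ ε → σ.reg 11 = 0 ∧ σ.reg 12 = 2) ∧ (ε < 1 → σ.reg 11 = t ∧ σ.reg 12 = 1)) ?_ le_rfl ?_)
  · refine Reach.ite (c := 2) (fun he => ?_) (fun he => ?_)
    · rw [Test.Holds, hσ.r13, h2, h8] at he
      refine Reach.after (c := 1) (Reach.instr ?_)
      simp only [List.foldl, Instr.run, State.setReg, NatOp.eval]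
      refine ⟨⟨?_, ?_, ?_, ?_, ?_, ?_, ?_, ?_, ?_, hσ.n0, hσ.n1, hσ.a0, hσ.a1⟩, ?_, h5, h6, hD,
        fun hc => absurd he (not_lt.2 hc), fun _ => ⟨?_, ?_⟩⟩ <;>
      simp [hσ.r0, hσ.r1, hσ.r4, hσ.r5, hσ.r6, hσ.r7, hσ.r8, hσ.r9, hσ.r13, h10]
    · rw [Test.Holds, hσ.r13, h2, h8] at he
      refine Reach.after (c := 1) (Reach.instr ?_)
      simp only [List.foldl, Instr.run, State.setReg]
      refine ⟨⟨?_, ?_, ?_, ?_, ?_, ?_, ?_, ?_, ?_, hσ.n0, hσ.n1, hσ.a0, hσ.a1⟩, ?_, h5, h6, hD,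
        fun _ => ⟨?_, ?_⟩, fun hc => absurd hc he⟩ <;>
      simp [hσ.r0, hσ.r1, hσ.r4, hσ.r5, hσ.r6, hσ.r7, hσ.r8, hσ.r9, hσ.r13, h10]
  · rintro σ ⟨hσ, h10, h5, h6, hD, hge, hlt⟩
    rcases le_or_gt 1 ε with hε | hε
    -- Register 11 holds `0` here, so no round is executed and the output stays `2`.
    · refine Reach.seq ((reach_fillLoop hσ h10 (hge hε).2).mono le_rfl ?_)
      rintro σ₁ ⟨⟨h3, hD1⟩, hu⟩
      have hσ₁ := hσ.unchanged hu (by norm_num) (by simp) (by simp)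
      refine (reach_roundLoop (N := 0) hσ₁ ((hu.reg 11 (by norm_num)).trans (hge hε).1)
        (by rw [hu.real 5 (by simp), h5]) (by rw [hu.real 6 (by simp), h6])
        (by rw [hD1, hD])).mono (by omega) ?_
      intro σ₂ h
      refine ⟨fun _ v hv => ?_, fun hc => absurd hc (not_lt.2 hε)⟩
      rw [h v hv, h3 v hv]
      simp
    · refine Reach.seq ((reach_fillLoop hσ h10 (hlt hε).2).mono le_rfl ?_)
      rintro σ₁ ⟨⟨h3, hD1⟩, hu⟩
      have hσ₁ := hσ.unchanged hu (by norm_num) (by simp) (by simp)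
      refine (reach_roundLoop (N := t) hσ₁ ((hu.reg 11 (by norm_num)).trans (hlt hε).1)
        (by rw [hu.real 5 (by simp), h5]) (by rw [hu.real 6 (by simp), h6])
        (by rw [hD1, hD])).mono le_rfl ?_
      intro σ₂ h
      refine ⟨fun hc => absurd hε (not_lt.2 hc), fun _ v hv => ?_⟩
      rw [h v hv, h3 v hv]
      simp

end Correct

/-! ### Running time and error probability -/

/-- Linear terms are absorbed by `d ≤ d²` and `m ≤ m²`, additive constants by `T ≥ 1` and `m ≥ 1`,
and the cost outside the rounds by `t ≥ 1`. -/
lemma totalCost_le {d m n s t T : ℕ} (hm : 1 ≤ m) (ht : 1 ≤ t) (hT : 1 ≤ T)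
    (hs : s ≤ 2 * (m * n)) :
    totalCost d m n s t T ≤ 60 * ((d ^ 2 + T) * (m * n * t) + m ^ 2 * t) := by
  have hd : d ≤ d ^ 2 := Nat.le_self_pow two_ne_zero d
  have hm2 : m ≤ m ^ 2 := Nat.le_self_pow two_ne_zero m
  have h1 : (s - 1) * (T + (d + 1) * (d * 6 + 9) + 6) ≤
      2 * (m * n) * (21 * (d ^ 2 + T)) := by
    refine Nat.mul_le_mul (by omega) ?_
    calc T + (d + 1) * (d * 6 + 9) + 6 = T + (6 * d ^ 2 + 15 * d + 15) := by ring
      _ ≤ 21 * (d ^ 2 + T) := by omega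
  have h2 : m * n * ((d + 1) * 9 + 9) ≤ m * n * (18 * (d ^ 2 + T)) :=
    Nat.mul_le_mul_left _ (by omega)
  have h3 : m * (m * 9 + 8) ≤ 17 * m ^ 2 := by nlinarith
  have h4 : roundCost d m n s T + 2 ≤ 60 * ((d ^ 2 + T) * (m * n)) + 25 * m ^ 2 := by
    rw [roundCost]
    have e1 : 2 * (m * n) * (21 * (d ^ 2 + T)) = 42 * ((d ^ 2 + T) * (m * n)) := by ring
    have e2 : m * n * (18 * (d ^ 2 + T)) = 18 * ((d ^ 2 + T) * (m * n)) := by ring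
    omega
  have h5 : t * (roundCost d m n s T + 2) ≤
      60 * ((d ^ 2 + T) * (m * n * t)) + 25 * (m ^ 2 * t) := by
    refine (Nat.mul_le_mul_left t h4).trans_eq ?_
    ring
  have h6 : m ^ 2 ≤ m ^ 2 * t := Nat.le_mul_of_pos_right _ ht
  have h7 : m * m = m ^ 2 := (sq m).symm
  rw [totalCost, h7]
  omega

/-- The choice of `t` makes the exponential at most `(δ/m²)²`, so the union bound totals `2δ²/m²`.
This is below `δ` because `m ≥ 2`; for `m = 1` it could fail. -/
lemma two_mul_exp_le {m t : ℕ} {ε δ : ℝ} (hm : 2 ≤ m) (hε : 0 < ε) (hδ : 0 < δ) (hδ1 : δ < 1)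
    (ht : (8 / ε) ^ 2 * Real.log ((m : ℝ) ^ 2 / δ) ≤ (t : ℝ)) :
    (m : ℝ) * (m * (2 * Real.exp (-(t * ε ^ 2 / 32)))) ≤ δ := by
  have hm' : (2 : ℝ) ≤ m := by exact_mod_cast hm
  have hpos : 0 < (m : ℝ) ^ 2 / δ := by positivity
  have h1 : 64 * Real.log ((m : ℝ) ^ 2 / δ) ≤ t * ε ^ 2 := by
    have h := mul_le_mul_of_nonneg_right ht (sq_nonneg ε)
    have e : (8 / ε) ^ 2 * Real.log ((m : ℝ) ^ 2 / δ) * ε ^ 2 =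
        64 * Real.log ((m : ℝ) ^ 2 / δ) := by
      field_simp
      ring
    linarith
  have h2 : Real.exp (-(t * ε ^ 2 / 32)) ≤ (δ / (m : ℝ) ^ 2) ^ 2 := by
    calc Real.exp (-(t * ε ^ 2 / 32)) ≤ Real.exp (2 * -Real.log ((m : ℝ) ^ 2 / δ)) :=
          Real.exp_le_exp.2 (by linarith)
      _ = (δ / (m : ℝ) ^ 2) ^ 2 := by
          rw [← Real.log_inv, inv_div, two_mul, Real.exp_add, Real.exp_log (by positivity)]
          exact (sq _).symm
  calc (m : ℝ) * (m * (2 * Real.exp (-(t * ε ^ 2 / 32))))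
      ≤ m * (m * (2 * (δ / (m : ℝ) ^ 2) ^ 2)) := by gcongr
    _ = 2 * δ ^ 2 / (m : ℝ) ^ 2 := by field_simp
    _ ≤ δ := by
      rw [div_le_iff₀ (by positivity)]
      have h4 : (4 : ℝ) ≤ (m : ℝ) ^ 2 := by nlinarith
      nlinarith [mul_le_mul_of_nonneg_left h4 hδ.le, mul_le_mul_of_nonneg_left hδ1.le hδ.le]

lemma one_le_of_le_log {m t : ℕ} {ε δ : ℝ} (hm : 1 ≤ m) (hε : 0 < ε) (hδ : 0 < δ) (hδ1 : δ < 1)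
    (ht : (8 / ε) ^ 2 * Real.log ((m : ℝ) ^ 2 / δ) ≤ (t : ℝ)) : 1 ≤ t := by
  have hm' : (1 : ℝ) ≤ m := by exact_mod_cast hm
  have h1 : 0 < Real.log ((m : ℝ) ^ 2 / δ) := by
    refine Real.log_pos ?_
    rw [lt_div_iff₀ hδ]
    nlinarith
  have h2 : (0 : ℝ) < t := lt_of_lt_of_le (by positivity) ht
  exact_mod_cast h2

/-! ### Error probability: from one pair to all pairs. -/

lemma prod_pairFactor {d m n s t : ℕ} (F : PiecewiseFamily d m n s)
    (w : ℕ → Fin (d + 1) → ℝ) (j k : Fin m) :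
    ∏ q ∈ Finset.range t, pairFactor F t (fun i => w (q * (s - 1) + i)) (j * m + k) =
      geomMean t (fun q => blockSum (s - 1) (F.cellDiff j k) w q) := by
  obtain ⟨h1, h2⟩ := PiecewiseFamily.mul_add_div_mod (j := j) k.2
  refine Finset.prod_congr rfl fun q _ => ?_
  rw [pairFactor, h1, h2, F.sketch_sub_sketch]

lemma measure_geomMean_blockSum_bad_le {d m n s t : ℕ} {F : PiecewiseFamily d m n s}
    (hF : F.IsDensityFamily) {μ : Measure (Fin (d + 1) → ℝ)} (hμ : IsCI d 0 1 μ) (ht : 1 ≤ t)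
    {ε : ℝ} (hε : 0 < ε) (hε1 : ε < 1) (j k : Fin m) :
    Measure.infinitePi (fun _ : ℕ => μ) {w |
      ¬ ((1 - ε) * geomMean t (fun q => blockSum (s - 1) (F.cellDiff j k) w q) ≤ F.dist j k ∧
        F.dist j k ≤ (1 + ε) * geomMean t (fun q => blockSum (s - 1) (F.cellDiff j k) w q))} ≤
      ENNReal.ofReal (2 * Real.exp (-(t * ε ^ 2 / 32))) := by
  have := hμ.isProbabilityMeasure
  rw [← F.coe_sum_unitNorm_cellDiff hF j k]
  exact measure_geomMean_bad_le (iIndepFun_blockSum μ (s - 1) (F.cellDiff j k))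
    (fun q => measurable_blockSum (s - 1) (F.cellDiff j k) q)
    (fun q => hμ.map_blockSum (s - 1) (F.natDegree_cellDiff_le j k) q) ht hε hε1

/-- Only subadditivity of the outer measure is used, so `S` need not be measurable. -/
lemma ofReal_one_sub_le_measure {Ω : Type*} [MeasurableSpace Ω] {P : Measure Ω}
    [IsProbabilityMeasure P] {S : Set Ω} {δ : ℝ} (hδ : 0 < δ)
    (h : P Sᶜ ≤ ENNReal.ofReal δ) : ENNReal.ofReal (1 - δ) ≤ P S := by
  have h1 : (1 : ENNReal) ≤ P S + ENNReal.ofReal δ := by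
    rw [← measure_univ (μ := P), ← union_compl_self S]
    exact (measure_union_le _ _).trans (by gcongr)
  rw [ENNReal.ofReal_sub _ hδ.le, ENNReal.ofReal_one]
  exact tsub_le_iff_right.2 h1

theorem ofReal_one_sub_le_measure_good {d m n s t : ℕ} {F : PiecewiseFamily d m n s}
    (hF : F.IsDensityFamily) {μ : Measure (Fin (d + 1) → ℝ)} (hμ : IsCI d 0 1 μ) (hm : 1 ≤ m)
    {ε δ : ℝ} (hε : 0 < ε) (hε1 : ε < 1) (hδ : 0 < δ) (hδ1 : δ < 1)
    (ht : (8 / ε) ^ 2 * Real.log ((m : ℝ) ^ 2 / δ) ≤ (t : ℝ)) :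
    ENNReal.ofReal (1 - δ) ≤ Measure.infinitePi (fun _ : ℕ => μ) {w | ∀ j k : Fin m,
      (1 - ε) * geomMean t (fun q => blockSum (s - 1) (F.cellDiff j k) w q) ≤ F.dist j k ∧
        F.dist j k ≤ (1 + ε) * geomMean t (fun q => blockSum (s - 1) (F.cellDiff j k) w q)} := by
  have := hμ.isProbabilityMeasure
  have ht1 := one_le_of_le_log hm hε hδ hδ1 ht
  refine ofReal_one_sub_le_measure hδ ?_
  rcases (show m = 1 ∨ 2 ≤ m by omega) with rfl | hm2
  -- For `m = 1` the only pair is diagonal: the sketches cancel for every stream, and both the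
  -- estimate and the distance are `0`.
  · refine le_of_eq_of_le ?_ zero_le
    refine (congrArg _ (compl_empty_iff.2 (eq_univ_of_forall fun w j k => ?_))).trans measure_empty
    have h0 : ∀ q, blockSum (s - 1) (F.cellDiff j k) w q = 0 := fun q => by
      rw [← F.sketch_sub_sketch, Subsingleton.elim j k, sub_self]
    rw [geomMean_zero ht1 fun q _ => h0 q, Subsingleton.elim j k, F.dist_self]
    simp
  · have hsub : {w : ℕ → Fin (d + 1) → ℝ | ∀ j k : Fin m,
        (1 - ε) * geomMean t (fun q => blockSum (s - 1) (F.cellDiff j k) w q) ≤ F.dist j k ∧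
        F.dist j k ≤ (1 + ε) * geomMean t
          (fun q => blockSum (s - 1) (F.cellDiff j k) w q)}ᶜ ⊆
        ⋃ j : Fin m, ⋃ k : Fin m, {w : ℕ → Fin (d + 1) → ℝ |
          ¬ ((1 - ε) * geomMean t (fun q => blockSum (s - 1) (F.cellDiff j k) w q) ≤
            F.dist j k ∧ F.dist j k ≤ (1 + ε) * geomMean t
              (fun q => blockSum (s - 1) (F.cellDiff j k) w q))} := by
      intro w hw
      simp only [mem_compl_iff, mem_ofPred_eq, not_forall] at hw
      obtain ⟨j, k, h⟩ := hw
      exact mem_iUnion₂.2 ⟨j, k, h⟩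
    refine (measure_mono hsub).trans ((measure_iUnion_fintype_le _ _).trans ?_)
    refine (Finset.sum_le_sum fun j _ => (measure_iUnion_fintype_le _ _).trans
      (Finset.sum_le_sum fun k _ =>
        measure_geomMean_blockSum_bad_le hF hμ ht1 hε hε1 j k)).trans ?_
    simp only [Finset.sum_const, Finset.card_univ, Fintype.card_fin, nsmul_eq_mul]
    rw [← ENNReal.ofReal_natCast, ← ENNReal.ofReal_mul (by positivity),
      ← ENNReal.ofReal_mul (by positivity)]
    exact ENNReal.ofReal_le_ofReal (two_mul_exp_le hm2 hε hδ hδ1 ht)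

end CauchyL1

end

theorem lemma3p1 :
    ∃ (prog : CauchyL1.Prog) (K : ℕ),
      ∀ (d m n s t T : ℕ) (ε δ : ℝ) (F : CauchyL1.PiecewiseFamily d m n s)
        (μ : Measure (Fin (d + 1) → ℝ)),
        F.IsDensityFamily → 1 ≤ m → 1 ≤ T → 0 < ε → 0 < δ → δ < 1 →
        (8 / ε) ^ 2 * Real.log ((m : ℝ) ^ 2 / δ) ≤ (t : ℝ) →
        CauchyL1.IsCI d 0 1 μ →
        ∃ final : (ℕ → Fin (d + 1) → ℝ) → CauchyL1.State,
          (∀ w : ℕ → Fin (d + 1) → ℝ, ∃ k : ℕ,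
            CauchyL1.Exec T w prog (F.initState t ε δ) (final w) k ∧
            k ≤ K * ((d ^ 2 + T) * (m * n * t) + m ^ 2 * t)) ∧
          ENNReal.ofReal (1 - δ) ≤
            Measure.infinitePi (fun _ : ℕ => μ)
              {w | ∀ j k : Fin m,
                (1 - ε) * (final w).output m j k ≤ F.dist j k ∧
                F.dist j k ≤ (1 + ε) * (final w).output m j k} := by
  refine ⟨CauchyL1.mainProg, 60, ?_⟩
  intro d m n s t T ε δ F μ hF hm hT hε hδ hδ1 ht hμ
  have := hμ.isProbabilityMeasure
  have ht1 := CauchyL1.one_le_of_le_log hm hε hδ hδ1 ht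
  choose final cost hexec hcost hge hlt using fun w : ℕ → Fin (d + 1) → ℝ =>
    CauchyL1.reach_mainProg (w := w) (T := T) F (t := t) ε δ
  refine ⟨final, fun w => ⟨cost w, hexec w,
    (hcost w).trans (CauchyL1.totalCost_le hm ht1 hT F.s_le)⟩, ?_⟩
  have hidx : ∀ j k : Fin m, (j * m + k : ℕ) < m * m := fun j k => by
    have := j.2
    have := k.2
    nlinarith
  -- For `ε ≥ 1` the output `2` is always correct: `(1 - ε) * 2 ≤ 0` and `2 ≤ (1 + ε) * 2`, while
  -- the distance lies in `[0, 2]`.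
  rcases le_or_gt 1 ε with hε1 | hε1
  · refine CauchyL1.ofReal_one_sub_le_measure hδ (le_of_eq_of_le ?_ zero_le)
    have huniv : {w : ℕ → Fin (d + 1) → ℝ | ∀ j k : Fin m, (1 - ε) * (final w).output m j k ≤ F.dist j k ∧
        F.dist j k ≤ (1 + ε) * (final w).output m j k} = univ := by
      refine eq_univ_of_forall fun w j k => ?_
      rw [CauchyL1.State.output, hge w hε1 _ (hidx j k)]
      have h0 := F.dist_nonneg j k
      have h2 := F.dist_le_two hF j k
      constructor <;> linarith
    rw [huniv, compl_univ, measure_empty]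
  · refine (CauchyL1.ofReal_one_sub_le_measure_good hF hμ hm hε hε1 hδ hδ1 ht).trans_eq ?_
    congr 1
    ext w
    refine forall₂_congr fun j k => ?_
    rw [CauchyL1.State.output, hlt w hε1 _ (hidx j k), CauchyL1.prod_pairFactor]
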